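/- Let $\mathcal I$ be an inverse category, i.e. a category with a degree function $\deg\colon \mathrm{ob}\,\mathcal I\to\mathbb N$ such that $\deg i>\deg j$ for every non-identity map $i\to j$, and suppose that every underslice $i/\mathcal I$ has finitely many objects (for instance, $\mathcal I$ is finite). Write $\partial(i/\mathcal I)$ for the full subcategory of $i/\mathcal I$ on the non-identity maps. Let $\mathbf C$ be a finitely complete category. Let $\mathcal I$ and $\mathbf C$ each be equipped with a wide subcategory of weak equivalences that contains all isomorphisms and satisfies 2-out-of-3, and let $\mathbf C$ be equipped with a pullback-stable wide subcategory of fibrations. For $p\colon B\to A$ and $K$ over $B$, a pushforward of $K$ along $p$ is an object $p_*K$ over $A$ with a map $\mathrm{ev}\colon p^*p_*K\to K$ over $B$ such that for each $X$ over $A$, the assignment $t\mapsto \mathrm{ev}\circ p^*t$ is a bijection from maps $X\to p_*K$ over $A$ to maps $p^*X\to K$ over $B$. Assume: * pushforwards in $\mathbf C$ of fibrations along fibrations exist and are fibrations; * weak equivalences are preserved by pullback along fibrations, and for every map $f\colon A'\to A$ the functor $f^*\colon\mathbf C/A\to\mathbf C/A'$ preserves weak equivalences between fibrations; * for every fibration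 $p$, the pushforward $p_*$ sends weak equivalences between fibrations over its source to weak equivalences; * for every commutative square $f p'=p g$ with $p\colon B\to A$, $p'\colon B'\to A'$ fibrations and $f\colon A'\to A$, $g\colon B'\to B$ weak equivalences, and every fibration $K\to B$, the comparison map $f^*p_*K\to p'_*g^*K$, i.e. the transpose of $p'^*f^*p_*K\cong g^*p^*p_*K\xrightarrow{g^*\mathrm{ev}}g^*K$, is a weak equivalence. For $X\in\mathbf C^{\mathcal I}$ let $M_iX=\lim(\partial(i/\mathcal I)\to\mathcal I\xrightarrow{X}\mathbf C)$. A Reedy fibration is a map $q\colon E\to B$ in $\mathbf C^{\mathcal I}$ such that for each $i$ the relative matching map $E_i\to B_i\times_{M_iB}M_iE$ is a fibration. A diagram is homotopical if it preserves weak equivalences, and a homotopical Reedy fibration is a Reedy fibration between homotopical diagrams. Suppose that for each $i\in\mathcal I$ and each non-identity weak equivalence $w\colon i\to j$, either all maps out of $i$ are weak equivalences or $w$ is an initial object of $\partial(i/\mathcal I)$. Then for all homotopical Reedy fibrations $p\colon B\to A$ and $k\colon K\to B$ in $\mathbf C^{\mathcal I}$, a pushforward of $k$ along $p$ in $\mathbf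 C^{\mathcal I}$ exists, and every such pushforward $p_*K\to A$ is a homotopical Reedy fibration. -/

import Mathlib

open CategoryTheory CategoryTheory.Limits

universe v₁ v₂ u₁ u₂

namespace InverseDiagrams

section InverseCategories

variable (I : Type u₁) [Category.{v₁} I]

/-- A category is *inverse* if its objects can be graded by natural numbers in such a way that
every non-identity morphism strictly decreases the degree. -/
def IsInverseCategory : Prop :=
  ∃ deg : I → ℕ, ∀ ⦃i j : I⦄ (f : i ⟶ j),
    ¬ MorphismProperty.identities I f → deg j < deg i

variable {I}

/-- The objects of the under category `i/I` that are different from the identity of `i`. -/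
def boundaryProp (i : I) : ObjectProperty (Under i) :=
  fun f => ¬ MorphismProperty.identities I f.hom

/-- The boundary `∂(i/I)`: the full subcategory of `i/I` on the non-identity morphisms. -/
abbrev Boundary (i : I) := (boundaryProp i).FullSubcategory

/-- A non-identity morphism `f : i ⟶ j`, as an object of `∂(i/I)`. -/
def Boundary.mk {i j : I} (f : i ⟶ j) (hf : ¬ MorphismProperty.identities I f) : Boundary i :=
  ⟨Under.mk f, hf⟩

instance finite_boundary (i : I) [Finite (Under i)] : Finite (Boundary i) :=
  Finite.of_injective (fun f : Boundary i => f.obj) (by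
    rintro ⟨f, hf⟩ ⟨g, hg⟩ h
    cases h
    rfl)

/-- If all under categories of `I` are finite, then so are the hom sets of `∂(i/I)`. -/
instance finite_boundary_hom [∀ i : I, Finite (Under i)] (i : I) (f g : Boundary i) :
    Finite (f ⟶ g) := by
  have h : Function.Injective
      (fun a : f ⟶ g => (Under.mk a.hom.right : Under f.obj.right)) := by
    intro a b hab
    apply ObjectProperty.hom_ext
    apply Under.UnderMorphism.ext
    have h : ∀ {x y : Under f.obj.right} (e : x = y), HEq x.hom y.hom := by
      rintro x _ rfl
      rfl
    exact eq_of_heq (h hab)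
  exact Finite.of_injective _ h

variable {C : Type u₂} [Category.{v₂} C]

/-- A category with finite limits has limits indexed by categories with finitely many objects
and finite hom sets, in whatever universes these live. -/
theorem hasLimitsOfShape_of_finite (J : Type u₁) [Category.{v₁} J] [Finite J]
    [∀ j j' : J, Finite (j ⟶ j')] [HasFiniteLimits C] : HasLimitsOfShape J C := by
  obtain ⟨n, ⟨e⟩⟩ := Finite.exists_equiv_fin J
  let K := InducedCategory J e.symm
  have hfin : ∀ a b : K, Finite (a ⟶ b) := fun a b =>
    Finite.of_injective (fun f : a ⟶ b => f.hom) (fun f g h => by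
      apply InducedCategory.hom_ext; exact h)
  have : LocallySmall.{0} K := ⟨fun a b => inferInstance⟩
  have hK : Finite (ShrinkHoms.{0} K) := Finite.of_equiv (Fin n) (Equiv.refl (Fin n))
  have : ∀ a b : ShrinkHoms.{0} K, Finite (a ⟶ b) := fun a b =>
    Finite.of_injective (equivShrink (ShrinkHoms.fromShrinkHoms a ⟶
      ShrinkHoms.fromShrinkHoms b)).symm (Equiv.injective _)
  let : FinCategory (ShrinkHoms.{0} K) :=
    { fintypeObj := Fintype.ofFinite _
      fintypeHom := fun a b => Fintype.ofFinite _ }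
  have : (inducedFunctor e.symm).EssSurj :=
    ⟨fun j => ⟨e j, ⟨eqToIso (e.symm_apply_apply j)⟩⟩⟩
  have : (inducedFunctor e.symm).IsEquivalence := { }
  have : HasLimitsOfShape (ShrinkHoms.{0} K) C := inferInstance
  have : HasLimitsOfShape K C :=
    hasLimitsOfShape_of_equivalence (ShrinkHoms.equivalence.{0} K).symm
  exact hasLimitsOfShape_of_equivalence (inducedFunctor e.symm).asEquivalence

instance hasLimitsOfShape_boundary [HasFiniteLimits C] [∀ i : I, Finite (Under i)] (i : I) :
    HasLimitsOfShape (Boundary i) C :=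
  hasLimitsOfShape_of_finite (Boundary i)

end InverseCategories

section Reedy

variable {I : Type u₁} [Category.{v₁} I] {C : Type u₂} [Category.{v₂} C]

/-- The composite `∂(i/I) ⥤ I ⥤ C`. -/
abbrev boundaryDiagram (X : I ⥤ C) (i : I) : Boundary i ⥤ C :=
  ((boundaryProp i).ι ⋙ Under.forget i) ⋙ X

variable [HasFiniteLimits C] [∀ i : I, Finite (Under i)]

/-- The matching object `M_i X`, the limit of `X` over `∂(i/I)`. -/
noncomputable def matchingObj (X : I ⥤ C) (i : I) : C :=
  limit (boundaryDiagram X i)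

/-- The projection `M_i X ⟶ X_j` at a non-identity morphism `f : i ⟶ j`. -/
noncomputable def matchingProj (X : I ⥤ C) (i : I) (f : Boundary i) :
    matchingObj X i ⟶ X.obj f.obj.right :=
  limit.π (boundaryDiagram X i) f

/-- The cone over `boundaryDiagram X i` with apex `X_i` and components `X_f` for `f : i ⟶ j`. -/
def boundaryCone (X : I ⥤ C) (i : I) : Cone (boundaryDiagram X i) where
  pt := X.obj i
  π :=
    { app := fun f => X.map f.obj.hom
      naturality := fun f g a => by
        have h : f.obj.hom ≫ a.hom.right = g.obj.hom := Under.w a.hom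
        exact (Category.id_comp _).trans (by rw [← h]; exact X.map_comp _ _) }

/-- The matching map `m_i X : X_i ⟶ M_i X`, whose component at `f : i ⟶ j` is `X_f`. -/
noncomputable def matchingMap (X : I ⥤ C) (i : I) : X.obj i ⟶ matchingObj X i :=
  limit.lift (boundaryDiagram X i) (boundaryCone X i)

/-- The map `M_i f : M_i X ⟶ M_i Y` induced by a map of diagrams. -/
noncomputable def matchingObjMap {X Y : I ⥤ C} (f : X ⟶ Y) (i : I) :
    matchingObj X i ⟶ matchingObj Y i :=
  limMap (Functor.whiskerLeft ((boundaryProp i).ι ⋙ Under.forget i) f)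

theorem matchingMap_proj (X : I ⥤ C) (i : I) (f : Boundary i) :
    matchingMap X i ≫ matchingProj X i f = X.map f.obj.hom :=
  limit.lift_π (boundaryCone X i) f

theorem matchingObjMap_proj {X Y : I ⥤ C} (a : X ⟶ Y) (i : I) (f : Boundary i) :
    matchingObjMap a i ≫ matchingProj Y i f = matchingProj X i f ≫ a.app f.obj.right :=
  limMap_π _ f

theorem matchingMap_naturality {X Y : I ⥤ C} (a : X ⟶ Y) (i : I) :
    a.app i ≫ matchingMap Y i = matchingMap X i ≫ matchingObjMap a i := by
  refine limit.hom_ext fun f => ?_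
  change (a.app i ≫ matchingMap Y i) ≫ matchingProj Y i f =
    (matchingMap X i ≫ matchingObjMap a i) ≫ matchingProj Y i f
  rw [Category.assoc, Category.assoc, matchingMap_proj, matchingObjMap_proj,
    ← Category.assoc, matchingMap_proj]
  exact (a.naturality f.obj.hom).symm

/-- The relative matching map `E_i ⟶ B_i ×_{M_i B} M_i E` of a map of diagrams `p : E ⟶ B`. -/
noncomputable def relativeMatchingMap {E B : I ⥤ C} (p : E ⟶ B) (i : I) :
    E.obj i ⟶ pullback (matchingMap B i) (matchingObjMap p i) :=
  pullback.lift (p.app i) (matchingMap E i) (matchingMap_naturality p i)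

/-- A map of diagrams is a *Reedy fibration* if all its relative matching maps are fibrations. -/
def IsReedyFibration (F : MorphismProperty C) {E B : I ⥤ C} (p : E ⟶ B) : Prop :=
  ∀ i : I, F (relativeMatchingMap p i)

/-- A diagram is *homotopical* if it sends weak equivalences to weak equivalences. -/
def IsHomotopical (WI : MorphismProperty I) (W : MorphismProperty C) (X : I ⥤ C) : Prop :=
  ∀ ⦃i j : I⦄ (w : i ⟶ j), WI w → W (X.map w)

/-- A *homotopical Reedy fibration* is a Reedy fibration between homotopical diagrams. -/
structure IsHomotopicalReedyFibration (WI : MorphismProperty I) (F W : MorphismProperty C)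
    {E B : I ⥤ C} (p : E ⟶ B) : Prop where
  reedy : IsReedyFibration F p
  source : IsHomotopical WI W E
  target : IsHomotopical WI W B

end Reedy

section Pushforwards

variable {D : Type u₂} [Category.{v₂} D] [HasPullbacks D]

/-- `P`, together with the evaluation map `ev : p^* P ⟶ K` over `B`, is a *pushforward* `p_* K` of
`K` along `p : B ⟶ A`: for each `X` over `A`, transposition along `ev` is a bijection from maps
`X ⟶ P` over `A` to maps `p^* X ⟶ K` over `B`. -/
def IsPushforward {A B : D} (p : B ⟶ A) (K : Over B) (P : Over A)
    (ev : (Over.pullback p).obj P ⟶ K) : Prop :=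
  ∀ (X : Over A) (u : (Over.pullback p).obj X ⟶ K),
    ∃! t : X ⟶ P, (Over.pullback p).map t ≫ ev = u

/-- Pushforwards of fibrations along fibrations exist and are fibrations. -/
structure FibrationsStableUnderPushforward (F : MorphismProperty D) : Prop where
  exists_pushforward : ∀ ⦃A B : D⦄ (p : B ⟶ A) (K : Over B), F p → F K.hom →
    ∃ (P : Over A) (ev : (Over.pullback p).obj P ⟶ K), IsPushforward p K P ev
  fibration : ∀ ⦃A B : D⦄ (p : B ⟶ A) (K : Over B) (P : Over A)
    (ev : (Over.pullback p).obj P ⟶ K), F p → F K.hom → IsPushforward p K P ev → F P.hom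

/-- For a commutative square with sides `p' : B' ⟶ A'`, `f : A' ⟶ A`, `g : B' ⟶ B`, `p : B ⟶ A`,
and `ev : p^* P ⟶ K` over `B`, this is the map `g^* ev : p'^* f^* P ≅ g^* p^* P ⟶ g^* K`
over `B'`. -/
noncomputable def pulledBackEv {A B A' B' : D} {p : B ⟶ A} {p' : B' ⟶ A'} {f : A' ⟶ A}
    {g : B' ⟶ B} (comm : p' ≫ f = g ≫ p) {K : Over B} {P : Over A}
    (ev : (Over.pullback p).obj P ⟶ K) :
    (Over.pullback p').obj ((Over.pullback f).obj P) ⟶ (Over.pullback g).obj K :=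
  Over.homMk
    (pullback.lift
      (pullback.lift
          (pullback.fst (pullback.snd P.hom f) p' ≫ pullback.fst P.hom f)
          (pullback.snd (pullback.snd P.hom f) p' ≫ g)
          (by rw [Category.assoc, Category.assoc, pullback.condition, ← comm,
                pullback.condition_assoc]) ≫ ev.left)
      (pullback.snd (pullback.snd P.hom f) p')
      (by
        have h : ev.left ≫ K.hom = pullback.snd P.hom p := Over.w ev
        rw [Category.assoc, h, pullback.lift_snd]))
    (pullback.lift_snd _ _ _)

/-- Weak equivalences are preserved by pullback along fibrations, and pullbacks preserve weak
equivalences between fibrations. -/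
structure PullbacksLogicallyBehaved (F W : MorphismProperty D) : Prop where
  along_fibration : ∀ ⦃X Y Z T : D⦄ (fst : T ⟶ X) (snd : T ⟶ Y) (q : X ⟶ Z) (w : Y ⟶ Z),
    IsPullback fst snd q w → F q → W w → W fst
  between_fibrations : ∀ ⦃A A' : D⦄ (f : A' ⟶ A) (E E' : Over A) (u : E ⟶ E'),
    F E.hom → F E'.hom → W u.left → W ((Over.pullback f).map u).left

/-- Pushforwards along fibrations preserve weak equivalences between fibrations, and for a
commutative square whose sides `p`, `p'` are fibrations and whose other sides `g`, `f` are weak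
equivalences, the comparison map `f^* p_* K ⟶ p'_* g^* K` (the transpose of `g^* ev`) is a weak
equivalence for each fibration `K` over `B`. -/
structure PushforwardsLogicallyBehaved (F W : MorphismProperty D) : Prop where
  between_fibrations : ∀ ⦃A B : D⦄ (p : B ⟶ A) (K K' : Over B) (u : K ⟶ K')
    (P P' : Over A) (ev : (Over.pullback p).obj P ⟶ K) (ev' : (Over.pullback p).obj P' ⟶ K')
    (t : P ⟶ P'),
    F p → F K.hom → F K'.hom → W u.left →
    IsPushforward p K P ev → IsPushforward p K' P' ev' →
    (Over.pullback p).map t ≫ ev' = ev ≫ u → W t.left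
  precomposition : ∀ ⦃A B A' B' : D⦄ (p : B ⟶ A) (p' : B' ⟶ A') (f : A' ⟶ A) (g : B' ⟶ B)
    (comm : p' ≫ f = g ≫ p) (K : Over B) (P : Over A) (P' : Over A')
    (ev : (Over.pullback p).obj P ⟶ K)
    (ev' : (Over.pullback p').obj P' ⟶ (Over.pullback g).obj K)
    (t : (Over.pullback f).obj P ⟶ P'),
    F p → F p' → W f → W g → F K.hom →
    IsPushforward p K P ev → IsPushforward p' ((Over.pullback g).obj K) P' ev' →
    (Over.pullback p').map t ≫ ev' = pulledBackEv comm ev → W t.left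

end Pushforwards

end InverseDiagrams

/-! The value of `p_*K` at `i` should classify maps `X ⟶ A_i` together with compatible families of
maps `X ×_{A_j} B_j ⟶ K_j` over `B_j`, one for each `i ⟶ j`. Such data is called a section (`Sec`),
and it makes sense over any cosieve `S` of maps out of `i`. Maps out of fibre products are described
by their action on generalized elements (`FibMap`), so that base change is mere precomposition and
no coherence isomorphisms between iterated pullbacks appear.

A finite cosieve is built up one map at a time, proper continuations first. Adding `f : i ⟶ j` to
`S'` means lifting the map `Q' ×_{A_j} B_j ⟶ B_j ×_{M_j B} M_j K`, determined by the section over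
`S'`, through the relative matching map of `K` at `j`. An object classifying such lifts
(`IsUnivLift`) is a pushforward of a fibration along the pullback `Q' ×_{A_j} B_j ⟶ Q'` of `p_j`. So
universal sections exist (`exists_isUniversal`); over all maps out of `i` they assemble into the
pushforward (`UniversalSections.isPushforward`). Over the boundary, `A_i ×_{M_i A} M_i P` carries
the universal section, and the last step, which adds the identity of `i`, exhibits the relative
matching map of `P ⟶ A` as a pushforward of a fibration. This gives Reedy fibrancy.

For homotopicality let `w : i ⟶ j` be a non-identity weak equivalence. If `w` is initial in
`∂(i/I)`, then `M_i X ≅ X_j`, and over a homotopical base `X_w` is a weak equivalence exactly when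
the relative matching map at `i` is. That of `P` is pushed forward from that of `K`, and pushforward
preserves weak equivalences between fibrations. If instead all maps out of `i` are weak
equivalences, each `p_j` in the construction may be replaced by `p_i`, changing the result only up
to weak equivalence; hence `P_i ≃ (p_i)_* K_i` (`exists_weakEquivalence_isUnivLift`). The same holds
at `j`, and `(p_i)_* K_i ⟶ (p_i)_*(B_w^* K_j) ⟵ A_w^* (p_j)_* K_j` are weak equivalences, so
2-out-of-3 applies to `P_w`. -/

namespace InverseDiagrams

/-! ### Universal lifts, and their identification with pushforwards. -/

section UniversalLifts

attribute [local simp] pullback.lift_fst pullback.lift_snd pullback.lift_fst_assoc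
  pullback.lift_snd_assoc

variable {C : Type u₂} [Category.{v₂} C]

/-- A map `A ×_D E ⟶ N` out of the fibre product of `β : A ⟶ D` and `π : E ⟶ D`, given by its
action on generalized elements. -/
structure FibMap {A D E : C} (β : A ⟶ D) (π : E ⟶ D) (N : C) where
  /-- The action on generalized elements. -/
  app : ∀ {T : C} (t : T ⟶ A) (y : T ⟶ E), t ≫ β = y ≫ π → (T ⟶ N)
  comp_app : ∀ {T T' : C} (r : T' ⟶ T) (t : T ⟶ A) (y : T ⟶ E) (w : t ≫ β = y ≫ π)
    (w' : (r ≫ t) ≫ β = (r ≫ y) ≫ π), r ≫ app t y w = app (r ≫ t) (r ≫ y) w'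

namespace FibMap

variable {A D E N : C} {β : A ⟶ D} {π : E ⟶ D}

theorem app_congr (n : FibMap β π N) {T : C} {t t' : T ⟶ A} {y y' : T ⟶ E} (ht : t = t')
    (hy : y = y') (w : t ≫ β = y ≫ π) :
    n.app t y w = n.app t' y' (ht ▸ hy ▸ w) := by
  subst ht hy; rfl

/-- Restriction of a map along `X ⟶ A`. -/
def pull (n : FibMap β π N) {X : C} (a : X ⟶ A) : FibMap (a ≫ β) π N where
  app t y w := n.app (t ≫ a) y (by simpa using w)
  comp_app r t y w w' := by
    rw [n.comp_app r _ _ _ (by simpa using w')]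
    exact n.app_congr (by simp) rfl _

/-- The second projection `A ×_D E ⟶ E`. -/
def snd (β : A ⟶ D) (π : E ⟶ D) : FibMap β π E where
  app _ y _ := y
  comp_app _ _ _ _ _ := rfl

/-- Composition with a map `N ⟶ N'`. -/
@[simps]
def post (n : FibMap β π N) {N' : C} (v : N ⟶ N') : FibMap β π N' where
  app t y w := n.app t y w ≫ v
  comp_app r t y w w' := by rw [← Category.assoc, n.comp_app r t y w w']

variable [HasPullbacks C]

/-- The corresponding map out of the pullback. -/
noncomputable def hom (n : FibMap β π N) : pullback β π ⟶ N :=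
  n.app (pullback.fst β π) (pullback.snd β π) pullback.condition

theorem lift_hom (n : FibMap β π N) {T : C} (t : T ⟶ A) (y : T ⟶ E) (w : t ≫ β = y ≫ π) :
    pullback.lift t y w ≫ n.hom = n.app t y w := by
  rw [hom, n.comp_app _ _ _ _ (by simpa only [pullback.lift_fst, pullback.lift_snd] using w)]
  exact n.app_congr (by simp) (by simp) _

theorem comp_hom (n : FibMap β π N) {T : C} (s : T ⟶ pullback β π) :
    s ≫ n.hom = n.app (s ≫ pullback.fst β π) (s ≫ pullback.snd β π)
      (by simp [pullback.condition]) := by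
  rw [hom, n.comp_app]

end FibMap

/-- `r : P ⟶ A` with `ε` is a universal lift of `n : A ×_D E ⟶ N` through `m : K ⟶ N`: maps
`X ⟶ P` over `A` correspond to lifts `X ×_D E ⟶ K` of the restriction of `n`. In other words,
`P` is the pushforward of `n^* K` along the projection `A ×_D E ⟶ A`. -/
structure IsUnivLift {A D E N K : C} {β : A ⟶ D} {π : E ⟶ D} (n : FibMap β π N) (m : K ⟶ N)
    {P : C} (r : P ⟶ A) (ε : FibMap (r ≫ β) π K) : Prop where
  fac : ∀ {T : C} (t : T ⟶ P) (y : T ⟶ E) (w : t ≫ r ≫ β = y ≫ π),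
    ε.app t y w ≫ m = n.app (t ≫ r) y (by simpa using w)
  exists_lift : ∀ {X : C} (a : X ⟶ A) (u : FibMap (a ≫ β) π K),
    (∀ {T : C} (t : T ⟶ X) (y : T ⟶ E) (w : t ≫ a ≫ β = y ≫ π),
      u.app t y w ≫ m = n.app (t ≫ a) y (by simpa using w)) →
    ∃ t : X ⟶ P, t ≫ r = a ∧ ∀ {T : C} (s : T ⟶ X) (y : T ⟶ E)
      (w : (s ≫ t) ≫ r ≫ β = y ≫ π) (w' : s ≫ a ≫ β = y ≫ π),
      ε.app (s ≫ t) y w = u.app s y w'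
  hom_ext : ∀ {X : C} (t t' : X ⟶ P), t ≫ r = t' ≫ r →
    (∀ {T : C} (s : T ⟶ X) (y : T ⟶ E) (w : (s ≫ t) ≫ r ≫ β = y ≫ π)
      (w' : (s ≫ t') ≫ r ≫ β = y ≫ π), ε.app (s ≫ t) y w = ε.app (s ≫ t') y w') → t = t'

section Basic

variable {A D E N K : C} {β : A ⟶ D} {π : E ⟶ D} {n : FibMap β π N} {m : K ⟶ N}

/-- Base change of universal lifts. -/
theorem IsUnivLift.baseChange {P : C} {r : P ⟶ A} {ε : FibMap (r ≫ β) π K}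
    (h : IsUnivLift n m r ε) {A' P' : C} {β' : A' ⟶ D} (n' : FibMap β' π N) {c : A' ⟶ A}
    (hβ : c ≫ β = β')
    (hn : ∀ {T : C} (t : T ⟶ A') (y : T ⟶ E) (w : t ≫ β' = y ≫ π)
      (w' : (t ≫ c) ≫ β = y ≫ π), n'.app t y w = n.app (t ≫ c) y w')
    {c' : P' ⟶ P} {r' : P' ⟶ A'} (sq : IsPullback c' r' r c) (ε' : FibMap (r' ≫ β') π K)
    (hε : ∀ {T : C} (t : T ⟶ P') (y : T ⟶ E) (w : t ≫ r' ≫ β' = y ≫ π)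
      (w' : (t ≫ c') ≫ r ≫ β = y ≫ π), ε'.app t y w = ε.app (t ≫ c') y w') :
    IsUnivLift n' m r' ε' := by
  subst hβ
  have key : ∀ {X : C} (t : X ⟶ P'), (t ≫ c') ≫ r = (t ≫ r') ≫ c := fun t => by
    simp [sq.w]
  refine ⟨fun t y w => ?_, fun a u hu => ?_, fun t t' ht hs => ?_⟩
  · have w₁ : (t ≫ c') ≫ r ≫ β = y ≫ π := by
      rw [← Category.assoc, key, ← w]; simp
    have w₂ : ((t ≫ r') ≫ c) ≫ β = y ≫ π := by rw [← w]; simp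
    rw [hε t y w w₁, h.fac, hn _ _ _ w₂]
    exact n.app_congr (key t) rfl _
  · obtain ⟨t, ht, ht'⟩ := h.exists_lift (a ≫ c)
      ⟨fun t y w => u.app t y (by simpa using w), fun r t y w w' => u.comp_app _ _ _ _ _⟩
      (fun t y w => by
        have w₁ : t ≫ a ≫ c ≫ β = y ≫ π := by simpa using w
        have w₂ : ((t ≫ a) ≫ c) ≫ β = y ≫ π := by simpa using w
        dsimp only
        rw [hu t y w₁, hn _ _ _ w₂]
        exact n.app_congr (by simp) rfl _)
    refine ⟨sq.lift t a ht, by simp, fun s y w w' => ?_⟩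
    have w₁ : (s ≫ t) ≫ r ≫ β = y ≫ π := by
      rw [Category.assoc, reassoc_of% ht]; simpa using w'
    rw [hε _ _ _ (by simpa using w₁), ← ht' s y w₁ (by simpa using w')]
    exact ε.app_congr (by simp) rfl _
  · refine sq.hom_ext (h.hom_ext _ _ (by rw [key, key, ht]) fun s y w w' => ?_) ht
    have e : ∀ {X T : C} (s : T ⟶ X) (t : X ⟶ P'),
        (s ≫ t ≫ c') ≫ r ≫ β = (s ≫ t) ≫ r' ≫ c ≫ β :=
      fun s t => by simp [sq.w_assoc]
    have := hs s y ((e s t).symm.trans w) ((e s t').symm.trans w')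
    rw [hε _ _ _ (by simpa using w), hε _ _ _ (by simpa using w')] at this
    rw [ε.app_congr (Category.assoc _ _ _).symm rfl, this]
    exact ε.app_congr (Category.assoc _ _ _) rfl _

/-- Lifts through a map are lifts through any of its pullbacks. -/
theorem IsUnivLift.ofIsPullback {N' K' : C} {n' : FibMap β π N'} {m' : K' ⟶ N'} {v : N ⟶ N'}
    {u : K ⟶ K'} (sq : IsPullback u m m' v)
    (hn : ∀ {T : C} (t : T ⟶ A) (y : T ⟶ E) (w : t ≫ β = y ≫ π),
      n'.app t y w = n.app t y w ≫ v)
    {P : C} {r : P ⟶ A} {ε' : FibMap (r ≫ β) π K'} (h : IsUnivLift n' m' r ε')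
    (ε : FibMap (r ≫ β) π K)
    (hε : ∀ {T : C} (t : T ⟶ P) (y : T ⟶ E) (w : t ≫ r ≫ β = y ≫ π),
      ε.app t y w ≫ u = ε'.app t y w)
    (hε' : ∀ {T : C} (t : T ⟶ P) (y : T ⟶ E) (w : t ≫ r ≫ β = y ≫ π),
      ε.app t y w ≫ m = n.app (t ≫ r) y (by simpa using w)) :
    IsUnivLift n m r ε := by
  refine ⟨hε', fun a x hx => ?_, fun t t' ht hs => h.hom_ext _ _ ht fun s y w w' => ?_⟩
  · obtain ⟨t, ht, ht'⟩ := h.exists_lift a (x.post u) (fun t y w => by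
      rw [hn]; simp only [FibMap.post_app, Category.assoc, sq.w]; rw [reassoc_of% (hx t y w)])
    refine ⟨t, ht, fun s y w w' => sq.hom_ext ?_ ?_⟩
    · rw [hε, ht' s y w w']; rfl
    · rw [hε', hx]; exact n.app_congr (by simp [ht]) rfl _
  · rw [← hε, ← hε, hs]

/-- The identity of `A` is a universal lift through an isomorphism. -/
theorem isUnivLift_id (n : FibMap β π N) (ε : FibMap (𝟙 A ≫ β) π N)
    (hε : ∀ {T : C} (t : T ⟶ A) (y : T ⟶ E) (w : t ≫ 𝟙 A ≫ β = y ≫ π)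
      (w' : t ≫ β = y ≫ π), ε.app t y w = n.app t y w') :
    IsUnivLift n (𝟙 N) (𝟙 A) ε := by
  refine ⟨fun t y w => ?_, fun a x hx => ⟨a, by simp, fun s y w w' => ?_⟩,
    fun t t' ht _ => by simpa using ht⟩
  · rw [hε _ _ _ (by simpa using w), Category.comp_id]
    exact n.app_congr (by simp) rfl _
  · rw [hε _ _ _ (by simpa using w), ← hx s y w', Category.comp_id]

end Basic

section Pushforward

variable [HasPullbacks C] {A D E N K : C} {β : A ⟶ D} {π : E ⟶ D}

/-- The map `X ×_D E ⟶ K` corresponding to a map `X ×_A (A ×_D E) ⟶ K`. -/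
noncomputable def FibMap.ofHom {X : C} {a : X ⟶ A} (x : pullback a (pullback.fst β π) ⟶ K) :
    FibMap (a ≫ β) π K where
  app t y w := pullback.lift t (pullback.lift (t ≫ a) y (by simpa using w)) (by simp) ≫ x
  comp_app s t y w w' := by
    simp only [← Category.assoc]
    congr 1
    apply pullback.hom_ext
    · simp
    · apply pullback.hom_ext <;> simp

/-- The map `X ×_A (A ×_D E) ⟶ K` corresponding to a map `X ×_D E ⟶ K`. -/
noncomputable def FibMap.toHom {X : C} {a : X ⟶ A} (u : FibMap (a ≫ β) π K) :
    pullback a (pullback.fst β π) ⟶ K :=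
  u.app (pullback.fst _ _) (pullback.snd _ _ ≫ pullback.snd _ _)
    (by rw [pullback.condition_assoc, pullback.condition, Category.assoc])

theorem FibMap.ofHom_app {X : C} {a : X ⟶ A} (x : pullback a (pullback.fst β π) ⟶ K) {T : C}
    (t : T ⟶ X) (z : T ⟶ pullback β π) (w : t ≫ a = z ≫ pullback.fst β π) :
    (FibMap.ofHom x).app t (z ≫ pullback.snd β π)
      (by rw [reassoc_of% w, pullback.condition, Category.assoc]) = pullback.lift t z w ≫ x := by
  dsimp only [ofHom]
  congr 1
  apply pullback.hom_ext
  · simp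
  · apply pullback.hom_ext
    · simp [w]
    · simp

theorem FibMap.lift_toHom {X : C} {a : X ⟶ A} (u : FibMap (a ≫ β) π K) {T : C}
    (t : T ⟶ X) (z : T ⟶ pullback β π) (w : t ≫ a = z ≫ pullback.fst β π) :
    pullback.lift t z w ≫ u.toHom = u.app t (z ≫ pullback.snd β π)
      (by rw [reassoc_of% w, pullback.condition, Category.assoc]) := by
  rw [toHom, u.comp_app _ _ _ _ (by
    simp only [pullback.lift_fst, pullback.lift_snd_assoc, Category.assoc]
    rw [reassoc_of% w, pullback.condition])]
  exact u.app_congr (by simp) (by simp) _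

theorem FibMap.ofHom_toHom_app {X : C} {a : X ⟶ A} (u : FibMap (a ≫ β) π K) {T : C}
    (t : T ⟶ X) (y : T ⟶ E) (w : t ≫ a ≫ β = y ≫ π) :
    (FibMap.ofHom u.toHom).app t y w = u.app t y w := by
  dsimp only [ofHom]
  rw [u.lift_toHom]
  exact u.app_congr rfl (by simp) _

theorem FibMap.ofHom_comp_app {X P : C} {a : X ⟶ A} {r : P ⟶ A}
    (x : pullback r (pullback.fst β π) ⟶ K) (f : X ⟶ P) (hf : f ≫ r = a) {T : C}
    (t : T ⟶ X) (y : T ⟶ E) (w : t ≫ a ≫ β = y ≫ π) (w' : (t ≫ f) ≫ r ≫ β = y ≫ π) :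
    (FibMap.ofHom (pullback.lift (pullback.fst a (pullback.fst β π) ≫ f) (pullback.snd _ _)
      (by rw [Category.assoc, hf, pullback.condition]) ≫ x)).app t y w =
      (FibMap.ofHom x).app (t ≫ f) y w' := by
  subst hf
  dsimp only [ofHom]
  rw [← Category.assoc]
  congr 1
  apply pullback.hom_ext
  · simp
  · apply pullback.hom_ext <;> simp

/-- A map out of the pullback is recovered by evaluating it at the universal generalized element,
the pair of projections. -/
theorem FibMap.pullbackHom_ext {X : C} {a : X ⟶ A} {x x' : pullback a (pullback.fst β π) ⟶ K}
    (h : ∀ {T : C} (t : T ⟶ X) (y : T ⟶ E) (w : t ≫ a ≫ β = y ≫ π),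
      (FibMap.ofHom x).app t y w = (FibMap.ofHom x').app t y w) : x = x' := by
  have key : ∀ x : pullback a (pullback.fst β π) ⟶ K, x = (FibMap.ofHom x).app
      (pullback.fst _ _) (pullback.snd _ _ ≫ pullback.snd _ _)
      (by rw [pullback.condition_assoc, pullback.condition, Category.assoc]) := fun x => by
    rw [ofHom_app x _ _ pullback.condition]
    refine (Category.id_comp x).symm.trans ?_
    congr 1
    apply pullback.hom_ext <;> simp
  rw [key x, key x', h]

theorem FibMap.hom_comp_app {L : C} {X : C} {a : X ⟶ A}
    (x : pullback a (pullback.fst β π) ⟶ L) (l : L ⟶ K) {T : C}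
    (t : T ⟶ X) (y : T ⟶ E) (w : t ≫ a ≫ β = y ≫ π) :
    (FibMap.ofHom (x ≫ l)).app t y w = (FibMap.ofHom x).app t y w ≫ l := by
  simp [ofHom]

variable {n : FibMap β π N} {m : K ⟶ N} {L : Over (pullback β π)} {l : L.left ⟶ K}
  {P : C} {r : P ⟶ A} {ε : FibMap (r ≫ β) π K}

/-- The map `ρ^* P ⟶ L` over `A ×_D E` corresponding to a lift of `n`, where `L` is a pullback
of `m` along `n`, and `ρ : A ×_D E ⟶ A` is the projection. -/
noncomputable def IsUnivLift.ev (h : IsUnivLift n m r ε) (sq : IsPullback l L.hom m n.hom) :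
    (Over.pullback (pullback.fst β π)).obj (Over.mk r) ⟶ L :=
  Over.homMk (sq.lift ε.toHom (pullback.snd r (pullback.fst β π))
    (by
      rw [FibMap.toHom, h.fac, FibMap.comp_hom]
      exact n.app_congr pullback.condition rfl _))
    (sq.lift_snd _ _ _)

theorem IsUnivLift.ev_left_comp (h : IsUnivLift n m r ε) (sq : IsPullback l L.hom m n.hom) :
    (h.ev sq).left ≫ l = ε.toHom :=
  sq.lift_fst _ _ _

/-- A universal lift is a pushforward. -/
theorem IsUnivLift.isPushforward (h : IsUnivLift n m r ε) (sq : IsPullback l L.hom m n.hom) :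
    IsPushforward (pullback.fst β π) L (Over.mk r) (h.ev sq) := by
  intro X u
  have hu : u.left ≫ L.hom = pullback.snd X.hom (pullback.fst β π) := Over.w u
  obtain ⟨t, ht, ht'⟩ := h.exists_lift X.hom (FibMap.ofHom (u.left ≫ l)) (fun t y w => by
    rw [← FibMap.hom_comp_app, Category.assoc, sq.w, reassoc_of% hu]
    dsimp only [FibMap.ofHom]
    rw [pullback.lift_snd_assoc, FibMap.lift_hom])
  -- Having transpose `u` is restated on generalized elements, the form in which `exists_lift` and
  -- `hom_ext` speak; existence and uniqueness of the transpose then follow directly.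
  have hmap : ∀ t : X ⟶ Over.mk r, (Over.pullback (pullback.fst β π)).map t ≫ h.ev sq = u ↔
      ∀ {T : C} (s : T ⟶ X.left) (y : T ⟶ E) (w : (s ≫ t.left) ≫ r ≫ β = y ≫ π)
        (w' : s ≫ X.hom ≫ β = y ≫ π),
        ε.app (s ≫ t.left) y w = (FibMap.ofHom (u.left ≫ l)).app s y w' := by
    intro t
    have ht : t.left ≫ r = X.hom := Over.w t
    have e : ∀ {T : C} (s : T ⟶ X.left) (y : T ⟶ E) (w : (s ≫ t.left) ≫ r ≫ β = y ≫ π)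
        (w' : s ≫ X.hom ≫ β = y ≫ π),
        (FibMap.ofHom (((Over.pullback (pullback.fst β π)).map t ≫ h.ev sq).left ≫ l)).app s y w' =
          ε.app (s ≫ t.left) y w := fun s y w w' => by
      have : ((Over.pullback (pullback.fst β π)).map t ≫ h.ev sq).left ≫ l =
          pullback.lift (pullback.fst X.hom (pullback.fst β π) ≫ t.left) (pullback.snd _ _)
            (by rw [Category.assoc, ht, pullback.condition]) ≫ ε.toHom := by
        rw [Over.comp_left, Category.assoc, h.ev_left_comp]; rfl
      rw [← ε.ofHom_toHom_app, ← FibMap.ofHom_comp_app _ _ ht _ _ w' w]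
      exact congr_arg (fun x => (FibMap.ofHom x).app s y w') this
    refine ⟨fun H T s y w w' => by rw [← e s y w w', H], fun H => ?_⟩
    apply Over.OverMorphism.ext
    refine sq.hom_ext (FibMap.pullbackHom_ext fun s y w => ?_) ((Over.w _).trans (Over.w u).symm)
    have w' : (s ≫ t.left) ≫ r ≫ β = y ≫ π := by rw [← w, ← ht]; simp
    exact (e s y w' w).trans (H s y w' w)
  refine ⟨Over.homMk t ht, (hmap _).2 ht', fun t' h' => ?_⟩
  apply Over.OverMorphism.ext
  refine h.hom_ext _ _ ((Over.w t').trans ht.symm) fun s y w w' => ?_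
  have hX : s ≫ X.hom ≫ β = y ≫ π := by rw [← w', ← ht]; simp
  rw [(hmap t').1 h' s y w hX]
  exact (ht' s y w' hX).symm

/-- A pushforward is a universal lift. -/
theorem isUnivLift_of_isPushforward {P : Over A}
    {ev : (Over.pullback (pullback.fst β π)).obj P ⟶ L}
    (h : IsPushforward (pullback.fst β π) L P ev) (sq : IsPullback l L.hom m n.hom) :
    IsUnivLift n m P.hom (FibMap.ofHom (ev.left ≫ l)) := by
  have hev : ev.left ≫ L.hom = pullback.snd P.hom (pullback.fst β π) := Over.w ev
  have fac : ∀ {T : C} (t : T ⟶ P.left) (y : T ⟶ E) (w : t ≫ P.hom ≫ β = y ≫ π),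
      (FibMap.ofHom (ev.left ≫ l)).app t y w ≫ m = n.app (t ≫ P.hom) y (by simpa using w) := by
    intro T t y w
    rw [← FibMap.hom_comp_app, Category.assoc, sq.w, reassoc_of% hev]
    dsimp only [FibMap.ofHom]
    rw [pullback.lift_snd_assoc, FibMap.lift_hom]
  have hmap : ∀ {X : Over A} (t : X ⟶ P) {T : C} (s : T ⟶ X.left) (y : T ⟶ E)
      (w : (s ≫ t.left) ≫ P.hom ≫ β = y ≫ π) (w' : s ≫ X.hom ≫ β = y ≫ π),
      (FibMap.ofHom (((Over.pullback (pullback.fst β π)).map t ≫ ev).left ≫ l)).app s y w' =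
        (FibMap.ofHom (ev.left ≫ l)).app (s ≫ t.left) y w := by
    intro X t T s y w w'
    rw [← FibMap.ofHom_comp_app _ _ (Over.w t) _ _ w' w, Over.comp_left, Category.assoc]
    rfl
  refine ⟨fac, fun {X} a u hu => ?_, fun {X} t t' ht hs => ?_⟩
  · let v : (Over.pullback (pullback.fst β π)).obj (Over.mk a) ⟶ L :=
      Over.homMk (sq.lift u.toHom (pullback.snd a (pullback.fst β π))
        (by
          rw [FibMap.toHom, hu, FibMap.comp_hom]
          exact n.app_congr pullback.condition rfl _))
        (sq.lift_snd _ _ _)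
    have hv : v.left ≫ l = u.toHom := sq.lift_fst _ _ _
    obtain ⟨t, ht, -⟩ := h (Over.mk a) v
    refine ⟨t.left, Over.w t, fun s y w w' => ?_⟩
    rw [← hmap t s y w w', ht, hv, u.ofHom_toHom_app]
  · let t₁ : Over.mk (t' ≫ P.hom) ⟶ P := Over.homMk t ht
    let t₂ : Over.mk (t' ≫ P.hom) ⟶ P := Over.homMk t' rfl
    suffices t₁ = t₂ from congr_arg (fun x => x.left) this
    refine (h _ ((Over.pullback (pullback.fst β π)).map t₂ ≫ ev)).unique ?_ rfl
    apply Over.OverMorphism.ext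
    refine sq.hom_ext (FibMap.pullbackHom_ext fun s y w => ?_)
      ((Over.w _).trans (Over.w _).symm)
    have w₂ : (s ≫ t') ≫ P.hom ≫ β = y ≫ π := by simpa using w
    have w₁ : (s ≫ t) ≫ P.hom ≫ β = y ≫ π := by rw [Category.assoc, reassoc_of% ht]; simpa using w
    exact (hmap t₁ s y w₁ w).trans ((hs s y w₁ w₂).trans (hmap t₂ s y w₂ w).symm)

end Pushforward

end UniversalLifts

/-! ### Universal lifts of fibrations and their homotopy invariance. -/

section Fibrations

variable {C : Type u₂} [Category.{v₂} C] [HasPullbacks C] {A D E N K : C} {β : A ⟶ D}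
  {π : E ⟶ D} {n : FibMap β π N} {m : K ⟶ N} {P : C} {r : P ⟶ A} {ε : FibMap (r ≫ β) π K}
  {F W : MorphismProperty C} [F.IsStableUnderBaseChange]

/-- Universal lifts of fibrations along fibrations exist. -/
theorem FibrationsStableUnderPushforward.exists_isUnivLift
    (hF : FibrationsStableUnderPushforward F) (hπ : F π) (n : FibMap β π N) (hm : F m) :
    ∃ (P : C) (r : P ⟶ A) (ε : FibMap (r ≫ β) π K), IsUnivLift n m r ε := by
  -- The projection `A ×_D E ⟶ A` is a pullback of `π` and `n^* K` is a pullback of `m`, so both are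
  -- fibrations.
  obtain ⟨P, ev, h⟩ := hF.exists_pushforward (pullback.fst β π)
    ((Over.pullback n.hom).obj (Over.mk m)) (F.pullback_fst _ _ hπ) (F.pullback_snd _ _ hm)
  exact ⟨P.left, P.hom, _, isUnivLift_of_isPushforward h (IsPullback.of_hasPullback m n.hom)⟩

/-- Universal lifts of fibrations along fibrations are fibrations. -/
theorem IsUnivLift.fibration (h : IsUnivLift n m r ε) (hF : FibrationsStableUnderPushforward F)
    (hπ : F π) (hm : F m) : F r :=
  hF.fibration (pullback.fst β π) ((Over.pullback n.hom).obj (Over.mk m)) (Over.mk r)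
    (h.ev (IsPullback.of_hasPullback m n.hom)) (F.pullback_fst _ _ hπ) (F.pullback_snd _ _ hm)
    (h.isPushforward _)

/-- Pulling `u` back along `n` gives a weak equivalence `n^* K ⟶ n^* K'` between fibrations over `A
×_D E`, and `t` is its image under pushforward to `A`. -/
theorem IsUnivLift.weakEquivalence_of_over (hpb : PullbacksLogicallyBehaved F W)
    (hpf : PushforwardsLogicallyBehaved F W) (h : IsUnivLift n m r ε)
    {K' : C} {m' : K' ⟶ N} {P' : C} {r' : P' ⟶ A} {ε' : FibMap (r' ≫ β) π K'}
    (h' : IsUnivLift n m' r' ε') (u : K ⟶ K') (hu : u ≫ m' = m) (t : P ⟶ P') (ht : t ≫ r' = r)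
    (hε : ∀ {T : C} (s : T ⟶ P) (y : T ⟶ E) (w : s ≫ r ≫ β = y ≫ π)
      (w' : (s ≫ t) ≫ r' ≫ β = y ≫ π), ε'.app (s ≫ t) y w' = ε.app s y w ≫ u)
    (hπ : F π) (hm : F m) (hm' : F m') (hWu : W u) : W t := by
  let L := (Over.pullback n.hom).obj (Over.mk m)
  let L' := (Over.pullback n.hom).obj (Over.mk m')
  let U : L ⟶ L' := (Over.pullback n.hom).map (Over.homMk u hu)
  have sq : IsPullback (pullback.fst m n.hom) L.hom m n.hom := IsPullback.of_hasPullback m n.hom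
  have sq' : IsPullback (pullback.fst m' n.hom) L'.hom m' n.hom :=
    IsPullback.of_hasPullback m' n.hom
  have hU : U.left ≫ pullback.fst m' n.hom = pullback.fst m n.hom ≫ u := pullback.lift_fst _ _ _
  refine hpf.between_fibrations (pullback.fst β π) L L' U (Over.mk r) (Over.mk r') (h.ev sq)
    (h'.ev sq') (Over.homMk t ht) (F.pullback_fst _ _ hπ) (F.pullback_snd _ _ hm)
    (F.pullback_snd _ _ hm') (hpb.between_fibrations _ _ _ _ hm hm' hWu) (h.isPushforward sq)
    (h'.isPushforward sq') ?_
  apply Over.OverMorphism.ext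
  refine sq'.hom_ext (FibMap.pullbackHom_ext fun s y w => ?_)
    ((Over.w _).trans (Over.w (h.ev sq ≫ U)).symm)
  have w' : (s ≫ t) ≫ r' ≫ β = y ≫ π := by rw [Category.assoc, reassoc_of% ht]; exact w
  rw [Over.comp_left, Over.comp_left, Category.assoc, Category.assoc, hU, h'.ev_left_comp,
    reassoc_of% (h.ev_left_comp sq)]
  refine (FibMap.ofHom_comp_app ε'.toHom t ht s y w w').trans ?_
  rw [FibMap.ofHom_toHom_app, hε s y w w']
  exact ((FibMap.hom_comp_app ε.toHom u s y w).trans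
    (congr_arg (· ≫ u) (ε.ofHom_toHom_app s y w))).symm

/-- Universal lifts along a fixed fibration preserve weak equivalences of fibrations. -/
theorem IsUnivLift.weakEquivalence_of_fibration_map [W.HasTwoOutOfThreeProperty]
    (hpb : PullbacksLogicallyBehaved F W)
    (hpf : PushforwardsLogicallyBehaved F W) (h : IsUnivLift n m r ε)
    {N' K' : C} {n' : FibMap β π N'} {m' : K' ⟶ N'} {P' : C} {r' : P' ⟶ A}
    {ε' : FibMap (r' ≫ β) π K'} (h' : IsUnivLift n' m' r' ε')
    (v : N ⟶ N') (u : K ⟶ K') (hu : u ≫ m' = m ≫ v)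
    (hn : ∀ {T : C} (t : T ⟶ A) (y : T ⟶ E) (w : t ≫ β = y ≫ π),
      n'.app t y w = n.app t y w ≫ v) (t : P ⟶ P') (ht : t ≫ r' = r)
    (hε : ∀ {T : C} (s : T ⟶ P) (y : T ⟶ E) (w : s ≫ r ≫ β = y ≫ π)
      (w' : (s ≫ t) ≫ r' ≫ β = y ≫ π), ε'.app (s ≫ t) y w' = ε.app s y w ≫ u)
    (hπ : F π) (hm : F m) (hm' : F m') (hWu : W u) (hWv : W v) : W t := by
  have sq := (IsPullback.of_hasPullback m' v)
  have hfac : ∀ {T : C} (t : T ⟶ P') (y : T ⟶ E) (w : t ≫ r' ≫ β = y ≫ π),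
      ε'.app t y w ≫ m' = n.app (t ≫ r') y (by simpa using w) ≫ v :=
    fun t y w => by rw [h'.fac, hn]
  -- Lifts of `n'` through `m'` are the same as lifts of `n` through `v^* K' ⟶ N`. This reduces to
  -- the case of a common target, with `K ⟶ v^* K'` in place of `u`.
  let ε'' : FibMap (r' ≫ β) π (pullback m' v) :=
    { app := fun t y w => pullback.lift (ε'.app t y w) (n.app (t ≫ r') y (by simpa using w))
        (hfac t y w)
      comp_app := fun s t y w w' => by
        apply pullback.hom_ext
        · simpa [pullback.lift_fst] using ε'.comp_app s t y w w'
        · rw [Category.assoc, pullback.lift_snd, pullback.lift_snd,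
            n.comp_app _ _ _ _ (by simpa using w')]
          exact n.app_congr (by simp) rfl _ }
  have h'' : IsUnivLift n (pullback.snd m' v) r' ε'' :=
    h'.ofIsPullback sq hn ε'' (fun t y w => pullback.lift_fst _ _ _)
      (fun t y w => pullback.lift_snd _ _ _)
  refine h.weakEquivalence_of_over hpb hpf h'' (pullback.lift u m hu) (pullback.lift_snd _ _ _) t
    ht (fun s y w w' => ?_) hπ hm (F.pullback_snd _ _ hm') ?_
  · apply pullback.hom_ext
    · rw [Category.assoc, pullback.lift_fst, pullback.lift_fst, hε]
    · rw [Category.assoc, pullback.lift_snd, pullback.lift_snd, h.fac]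
      exact n.app_congr (by rw [Category.assoc, ht]) rfl _
  -- The projection `v^* K' ⟶ K'` is a weak equivalence, being the pullback of `v` along the
  -- fibration `m'`; 2-out-of-3 then handles `K ⟶ v^* K'`.
  · refine W.of_postcomp _ (pullback.fst m' v) (hpb.along_fibration _ _ _ _ sq hm' hWv) ?_
    rwa [pullback.lift_fst]

/-- Replacing the fibration along which one pushes forward by a weakly equivalent one changes
universal lifts by a weak equivalence. -/
theorem IsUnivLift.weakEquivalence_of_base_map [W.HasTwoOutOfThreeProperty]
    (hW : MorphismProperty.isomorphisms C ≤ W) (hpb : PullbacksLogicallyBehaved F W)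
    (hpf : PushforwardsLogicallyBehaved F W) (h : IsUnivLift n m r ε)
    {D' E' : C} {β' : A ⟶ D'} {π' : E' ⟶ D'} {n' : FibMap β' π' N} {P' : C} {r' : P' ⟶ A}
    {ε' : FibMap (r' ≫ β') π' K} (h' : IsUnivLift n' m r' ε')
    (d : D' ⟶ D) (e : E' ⟶ E) (hβ : β' ≫ d = β) (he : e ≫ π = π' ≫ d)
    (hn : ∀ {T : C} (t : T ⟶ A) (y : T ⟶ E') (w : t ≫ β' = y ≫ π') (w' : t ≫ β = (y ≫ e) ≫ π),
      n'.app t y w = n.app t (y ≫ e) w') (t : P ⟶ P') (ht : t ≫ r' = r)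
    (hε : ∀ {T : C} (s : T ⟶ P) (y : T ⟶ E') (w : s ≫ r ≫ β = (y ≫ e) ≫ π)
      (w' : (s ≫ t) ≫ r' ≫ β' = y ≫ π'), ε'.app (s ≫ t) y w' = ε.app s (y ≫ e) w)
    (hπ : F π) (hπ' : F π') (hm : F m) (hWd : W d) (hWe : W e) : W t := by
  have : W.ContainsIdentities := ⟨fun X => hW _ (inferInstanceAs (IsIso (𝟙 X)))⟩
  let g : pullback β' π' ⟶ pullback β π := pullback.map _ _ _ _ (𝟙 A) e d (by simpa) he.symm
  have hg₁ : g ≫ pullback.fst β π = pullback.fst β' π' :=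
    (pullback.lift_fst _ _ _).trans (Category.comp_id _)
  have hg₂ : g ≫ pullback.snd β π = pullback.snd β' π' ≫ e := pullback.lift_snd _ _ _
  have hgn : g ≫ n.hom = n'.hom := by
    rw [FibMap.comp_hom]
    exact (n.app_congr hg₁ hg₂ _).trans (hn _ _ pullback.condition _).symm
  let L := (Over.pullback n.hom).obj (Over.mk m)
  let L' := (Over.pullback g).obj L
  have sq : IsPullback (pullback.fst m n.hom) L.hom m n.hom := IsPullback.of_hasPullback m n.hom
  have sq₁ : IsPullback (pullback.fst L.hom g) L'.hom L.hom g := IsPullback.of_hasPullback L.hom g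
  have sq' : IsPullback (pullback.fst L.hom g ≫ pullback.fst m n.hom) L'.hom m n'.hom := by
    rw [← hgn]
    exact (sq₁.flip.paste_vert sq.flip).flip
  -- Up to isomorphism `g` is the pullback along `β'` of the gap map `E' ⟶ D' ×_D E` between
  -- fibrations over `D'`. The gap map is a weak equivalence by 2-out-of-3, since `D' ×_D E ⟶ E` is
  -- the pullback of `d` along `π`.
  have hWg : W g := by
    subst hβ
    let H := (Over.pullback d).obj (Over.mk π)
    let j : Over.mk π' ⟶ H := Over.homMk (pullback.lift e π' he) (pullback.lift_snd _ _ _)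
    have hj : W j.left := W.of_postcomp _ (pullback.fst π d)
      (hpb.along_fibration _ _ _ _ (IsPullback.of_hasPullback π d) hπ hWd)
      (by rwa [show j.left ≫ pullback.fst π d = e from pullback.lift_fst _ _ _])
    have hj' := hpb.between_fibrations β' _ _ j hπ' (F.pullback_snd _ _ hπ) hj
    have sqH : IsPullback (pullback.snd (pullback.snd π d) β')
        (pullback.fst (pullback.snd π d) β' ≫ pullback.fst π d) (β' ≫ d) π :=
      ((IsPullback.of_hasPullback (pullback.snd π d) β').paste_horiz
        (IsPullback.of_hasPullback π d)).flip
    have hg : g = (pullbackSymmetry β' π').hom ≫ ((Over.pullback β').map j).left ≫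
        sqH.isoPullback.hom := by
      have e₁ : ((Over.pullback β').map j).left ≫ pullback.fst (pullback.snd π d) β' =
        pullback.fst π' β' ≫ pullback.lift e π' he := pullback.lift_fst _ _ _
      have e₂ : ((Over.pullback β').map j).left ≫ pullback.snd (pullback.snd π d) β' =
        pullback.snd π' β' := pullback.lift_snd _ _ _
      apply pullback.hom_ext
      · rw [Category.assoc, Category.assoc, sqH.isoPullback_hom_fst, e₂,
          pullbackSymmetry_hom_comp_snd, hg₁]
      · rw [Category.assoc, Category.assoc, sqH.isoPullback_hom_snd, reassoc_of% e₁,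
          pullback.lift_fst, pullbackSymmetry_hom_comp_fst_assoc, hg₂]
    rw [hg]
    exact W.comp_mem _ _ (hW _ (inferInstanceAs (IsIso _)))
      (W.comp_mem _ _ hj' (hW _ (inferInstanceAs (IsIso _))))
  have comm : pullback.fst β' π' ≫ 𝟙 A = g ≫ pullback.fst β π := by simp [hg₁]
  -- The comparison axiom is used with `f = 𝟙 A`. Its source is then `(𝟙 A)^* P` instead of `P`, so
  -- `t` is precomposed with the isomorphism `(𝟙 A)^* P ≅ P`, which is cancelled at the end.
  let T₀ : (Over.pullback (𝟙 A)).obj (Over.mk r) ⟶ Over.mk r' :=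
    Over.homMk (pullback.fst r (𝟙 A) ≫ t) (by
      dsimp; rw [Category.assoc, ht, pullback.condition, Category.comp_id])
  have hT₀ : W T₀.left := by
    refine hpf.precomposition (pullback.fst β π) (pullback.fst β' π') (𝟙 A) g comm L (Over.mk r)
      (Over.mk r') (h.ev sq) (h'.ev sq') T₀ (F.pullback_fst _ _ hπ) (F.pullback_fst _ _ hπ')
      (W.id_mem _) hWg (F.pullback_snd _ _ hm) (h.isPushforward sq) (h'.isPushforward sq') ?_
    apply Over.OverMorphism.ext
    refine sq'.hom_ext (FibMap.pullbackHom_ext fun s y w => ?_)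
      ((Over.w _).trans (Over.w (pulledBackEv comm (h.ev sq))).symm)
    have hs : s ≫ pullback.fst r (𝟙 A) ≫ r ≫ β = s ≫ pullback.snd r (𝟙 A) ≫ β := by
      rw [pullback.condition_assoc, Category.id_comp]
    have w' : (s ≫ T₀.left) ≫ r' ≫ β' = y ≫ π' := by
      rw [Category.assoc, ← Category.assoc T₀.left]
      exact (congr_arg (fun x => s ≫ x ≫ β') (Over.w T₀)).trans w
    have w₁ : (s ≫ pullback.fst r (𝟙 A)) ≫ r ≫ β = (y ≫ e) ≫ π := by
      rw [Category.assoc, hs, ← hβ, Category.assoc, he, ← Category.assoc y, ← w]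
      simp
    trans ε'.app (s ≫ T₀.left) y w'
    · rw [Over.comp_left, Category.assoc, h'.ev_left_comp]
      refine (FibMap.ofHom_comp_app ε'.toHom T₀.left (Over.w T₀) s y w w').trans ?_
      rw [FibMap.ofHom_toHom_app]
    · have hev : (pulledBackEv comm (h.ev sq)).left ≫ pullback.fst L.hom g ≫ pullback.fst m n.hom =
          pullback.lift
          (pullback.fst (pullback.snd r (𝟙 A)) (pullback.fst β' π') ≫ pullback.fst r (𝟙 A))
          (pullback.snd (pullback.snd r (𝟙 A)) (pullback.fst β' π') ≫ g)
          (by rw [Category.assoc, Category.assoc, pullback.condition, ← comm,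
                pullback.condition_assoc]) ≫ ε.toHom := by
        refine Eq.trans ?_ (congr_arg (pullback.lift _ _ _ ≫ ·)
          (h.ev_left_comp (L := L) (l := pullback.fst m n.hom) sq))
        simp only [← Category.assoc]
        congr 1
        exact pullback.lift_fst _ _ _
      have w₂ := (congr_arg (· ≫ r' ≫ β') (Category.assoc s (pullback.fst r (𝟙 A)) t)).trans w'
      rw [hev]
      refine ((ε'.app_congr (Category.assoc s (pullback.fst r (𝟙 A)) t).symm rfl w').trans
        (hε _ _ w₁ w₂)).trans (Eq.symm ?_)
      dsimp only [FibMap.ofHom]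
      rw [← Category.assoc]
      have : pullback.lift s (pullback.lift (s ≫ pullback.snd r (𝟙 A)) y (by simpa using w))
          (by rw [pullback.lift_fst]) ≫ pullback.lift
          (pullback.fst (pullback.snd r (𝟙 A)) (pullback.fst β' π') ≫ pullback.fst r (𝟙 A))
          (pullback.snd (pullback.snd r (𝟙 A)) (pullback.fst β' π') ≫ g)
          (by rw [Category.assoc, Category.assoc, pullback.condition, ← comm,
                pullback.condition_assoc]) =
          pullback.lift (s ≫ pullback.fst r (𝟙 A))
            (pullback.lift (s ≫ pullback.snd r (𝟙 A)) y (by simpa using w) ≫ g)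
            (by rw [Category.assoc, Category.assoc, hg₁, pullback.lift_fst, pullback.condition,
              Category.comp_id]) := by
        apply pullback.hom_ext
        · simp only [Category.assoc, pullback.lift_fst, pullback.lift_fst_assoc]
        · simp only [Category.assoc, pullback.lift_snd, pullback.lift_snd_assoc]
      refine (congr_arg (· ≫ ε.toHom) this).trans ?_
      rw [FibMap.lift_toHom]
      exact ε.app_congr rfl (by rw [Category.assoc, hg₂, pullback.lift_snd_assoc]) _
  exact W.of_precomp (pullback.fst r (𝟙 A)) t (hW _ (inferInstanceAs (IsIso _))) hT₀

end Fibrations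

/-! ### Frames, sections over cosieves, and extension by one map. -/

section Sections

variable {I : Type u₁} [Category.{v₁} I] {C : Type u₂} [Category.{v₂} C]

/-- Transport of a map `A ×_D E ⟶ N` along an equality of maps `A ⟶ D`. -/
def FibMap.cast {A D E N : C} {β β' : A ⟶ D} {π : E ⟶ D} (n : FibMap β π N) (h : β = β') :
    FibMap β' π N where
  app t y w := n.app t y (by rw [h, w])
  comp_app r t y w w' := n.comp_app r t y _ _

/-- Membership in `MorphismProperty.identities` identifies the endpoints as well as the map, so this
is a genuine equality of objects. It allows cosieves to be treated as plain sets of objects of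
`i/I`. -/
theorem Under.eq_of_identities {i : I} {f f' : Under i} (a : f ⟶ f')
    (h : MorphismProperty.identities I a.right) : f' = f := by
  have w : f.hom ≫ a.right = f'.hom := Under.w a
  generalize a.right = x at h w
  rcases f with ⟨⟨⟨⟩⟩, j, f⟩
  rcases f' with ⟨⟨⟨⟩⟩, j', f'⟩
  change j ⟶ j' at x
  change i ⟶ j at f
  change i ⟶ j' at f'
  change f ≫ x = f' at w
  change MorphismProperty.identities I x at h
  cases h
  rw [Category.comp_id] at w
  subst w
  rfl

/-- A frame at `i` consists of an object `base`, a map of diagrams `π : E ⟶ D`, and compatible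
maps `base ⟶ D_j` and `E_j ⟶ B_j` for all maps `i ⟶ j`. -/
structure Frame (B : I ⥤ C) (i : I) where
  base : C
  D : I ⥤ C
  E : I ⥤ C
  π : E ⟶ D
  α (f : Under i) : base ⟶ D.obj f.right
  α_map {f f' : Under i} (h : f ⟶ f') : α f ≫ D.map h.right = α f'
  e (f : Under i) : E.obj f.right ⟶ B.obj f.right
  e_map {f f' : Under i} (h : f ⟶ f') : e f ≫ B.map h.right = E.map h.right ≫ e f'

variable {B K : I ⥤ C} (k : K ⟶ B) {i : I} (φ : Frame B i)

theorem Frame.comp_π {X T : C} {t : X ⟶ T} {b : T ⟶ φ.base} {f f' : Under i}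
    {y : X ⟶ φ.E.obj f.right} (w : t ≫ b ≫ φ.α f = y ≫ φ.π.app f.right) (h : f ⟶ f') :
    t ≫ b ≫ φ.α f' = (y ≫ φ.E.map h.right) ≫ φ.π.app f'.right := by
  rw [Category.assoc, φ.π.naturality, ← φ.α_map h, ← reassoc_of% w]

/-- A section over a set `S` of maps out of `i`, with domain `T`: a map `T ⟶ base` together with
a compatible family of maps `T ×_{D_j} E_j ⟶ K_j` over `B_j` for all maps `i ⟶ j` in `S`. -/
structure Sec (S : Set (Under i)) (T : C) where
  base : T ⟶ φ.base
  fam (f : Under i) (hf : f ∈ S) : FibMap (base ≫ φ.α f) (φ.π.app f.right) (K.obj f.right)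
  fam_comp {f : Under i} (hf : f ∈ S) {X : C} (t : X ⟶ T) (y : X ⟶ φ.E.obj f.right)
    (w : t ≫ base ≫ φ.α f = y ≫ φ.π.app f.right) :
    (fam f hf).app t y w ≫ k.app f.right = y ≫ φ.e f
  fam_map {f f' : Under i} (hf : f ∈ S) (hf' : f' ∈ S) (h : f ⟶ f') {X : C} (t : X ⟶ T)
    (y : X ⟶ φ.E.obj f.right) (w : t ≫ base ≫ φ.α f = y ≫ φ.π.app f.right)
    (w' : t ≫ base ≫ φ.α f' = (y ≫ φ.E.map h.right) ≫ φ.π.app f'.right) :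
    (fam f hf).app t y w ≫ K.map h.right = (fam f' hf').app t (y ≫ φ.E.map h.right) w'

namespace Sec

variable {k φ} {S S' : Set (Under i)} {T : C}

/-- The type of `fam` depends on `base`. Comparing components on generalized elements, with a
compatibility proof for each base, avoids heterogeneous equality. -/
theorem ext' {σ τ : Sec k φ S T} (hb : σ.base = τ.base)
    (h : ∀ (f : Under i) (hf : f ∈ S) {X : C} (t : X ⟶ T) (y : X ⟶ φ.E.obj f.right)
      (w : t ≫ σ.base ≫ φ.α f = y ≫ φ.π.app f.right)
      (w' : t ≫ τ.base ≫ φ.α f = y ≫ φ.π.app f.right),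
      (σ.fam f hf).app t y w = (τ.fam f hf).app t y w') : σ = τ := by
  obtain ⟨b, x, _, _⟩ := σ
  obtain ⟨b', x', _, _⟩ := τ
  obtain rfl : b = b' := hb
  have : x = x' := by
    funext f hf
    have := fun (X : C) (t : X ⟶ T) y w => h f hf t y w w
    dsimp only at this
    cases hx : x f hf
    cases hx' : x' f hf
    simp only [hx, hx'] at this
    congr 1
    funext X t y w
    exact this X t y w
  subst this
  rfl

theorem fam_congr {σ τ : Sec k φ S T} (h : σ = τ) {f : Under i} (hf : f ∈ S) {X : C}
    {t t' : X ⟶ T} {y y' : X ⟶ φ.E.obj f.right} (ht : t = t') (hy : y = y')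
    (w : t ≫ σ.base ≫ φ.α f = y ≫ φ.π.app f.right)
    (w' : t' ≫ τ.base ≫ φ.α f = y' ≫ φ.π.app f.right) :
    (σ.fam f hf).app t y w = (τ.fam f hf).app t' y' w' := by
  subst h ht hy; rfl

theorem fam_app_congr (σ : Sec k φ S T) {j : I} {f f' : i ⟶ j} (h : f = f')
    (hf : Under.mk f ∈ S) (hf' : Under.mk f' ∈ S) {X : C}
    (t : X ⟶ T) {y y' : X ⟶ φ.E.obj j} (hy : y = y')
    (w : t ≫ σ.base ≫ φ.α (Under.mk f) = y ≫ φ.π.app j)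
    (w' : t ≫ σ.base ≫ φ.α (Under.mk f') = y' ≫ φ.π.app j) :
    (σ.fam (Under.mk f) hf).app t y w = (σ.fam (Under.mk f') hf').app t y' w' := by
  subst h hy; rfl

/-- Restriction along a map of domains. -/
@[simps]
def pull (σ : Sec k φ S T) {X : C} (a : X ⟶ T) : Sec k φ S X where
  base := a ≫ σ.base
  fam f hf := ((σ.fam f hf).pull a).cast (Category.assoc _ _ _).symm
  fam_comp := by
    intros
    exact σ.fam_comp _ _ _ _
  fam_map := by
    intros
    exact σ.fam_map _ _ _ _ _ _ _

theorem pull_pull (σ : Sec k φ S T) {X Y : C} (a : X ⟶ T) (b : Y ⟶ X) :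
    (σ.pull a).pull b = σ.pull (b ≫ a) :=
  ext' (Category.assoc _ _ _).symm fun f hf {_} _ _ _ _ =>
    (σ.fam f hf).app_congr (Category.assoc _ _ _) rfl _

theorem pull_id (σ : Sec k φ S T) : σ.pull (𝟙 T) = σ :=
  ext' (Category.id_comp _) fun f hf {_} _ _ _ _ =>
    (σ.fam f hf).app_congr (Category.comp_id _) rfl _

/-- Restriction to a smaller set of maps. -/
def restrict (hS : S' ⊆ S) (σ : Sec k φ S T) : Sec k φ S' T where
  base := σ.base
  fam f hf := σ.fam f (hS hf)
  fam_comp hf := σ.fam_comp (hS hf)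
  fam_map hf hf' h := σ.fam_map (hS hf) (hS hf') h

/-- A section is universal if every section is a unique restriction of it. -/
def IsUniversal (σ : Sec k φ S T) : Prop :=
  ∀ ⦃X : C⦄ (τ : Sec k φ S X), ∃! t : X ⟶ T, σ.pull t = τ

theorem IsUniversal.hom_ext {σ : Sec k φ S T} (h : σ.IsUniversal) {X : C} {t t' : X ⟶ T}
    (ht : σ.pull t = σ.pull t') : t = t' :=
  (h (σ.pull t')).unique ht rfl

theorem IsUniversal.of_isIso {σ : Sec k φ S T} (h : σ.IsUniversal) {T' : C} (a : T' ⟶ T)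
    [IsIso a] : (σ.pull a).IsUniversal := fun X τ => by
  obtain ⟨t, ht, ht'⟩ := h τ
  refine ⟨t ≫ inv a, by simpa [pull_pull] using ht, fun s hs => ?_⟩
  rw [← ht' (s ≫ a) ((σ.pull_pull a s).symm.trans hs)]
  simp

theorem IsUniversal.isIso {T' : C} {σ : Sec k φ S T} {τ : Sec k φ S T'} (h : σ.IsUniversal)
    (h' : τ.IsUniversal) {t : T' ⟶ T} (ht : σ.pull t = τ) : IsIso t := by
  obtain ⟨s, hs, -⟩ := h' σ
  refine ⟨s, h'.hom_ext ?_, h.hom_ext ?_⟩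
  · rw [← pull_pull, hs, ht, pull_id]
  · rw [← pull_pull, ht, hs, pull_id]

end Sec

/-- `S` is obtained from the cosieve `S'` by adding the map `f`, all of whose proper continuations
are in `S'`. -/
structure IsCosieveStep (S S' : Set (Under i)) (f : Under i) : Prop where
  mem_iff : ∀ h, h ∈ S ↔ h = f ∨ h ∈ S'
  notMem : f ∉ S'
  closed : ∀ ⦃h h' : Under i⦄, h ∈ S' → (h ⟶ h') → h' ∈ S'
  boundary : ∀ g : Boundary f.right, Under.mk (f.hom ≫ g.obj.hom) ∈ S'
  endo : ∀ a : f ⟶ f, a = 𝟙 f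

section Step

variable {k φ} {S S' : Set (Under i)} {f : Under i} {T : C}

theorem IsCosieveStep.subset (hf : IsCosieveStep S S' f) : S' ⊆ S := fun h hh =>
  (hf.mem_iff h).2 (Or.inr hh)

theorem IsCosieveStep.mem (hf : IsCosieveStep S S' f) : f ∈ S := (hf.mem_iff f).2 (Or.inl rfl)

variable [HasFiniteLimits C] [∀ i : I, Finite (Under i)]

theorem matchingObj_hom_ext {X : I ⥤ C} {i : I} {Y : C} {x y : Y ⟶ matchingObj X i}
    (h : ∀ g : Boundary i, x ≫ matchingProj X i g = y ≫ matchingProj X i g) : x = y :=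
  limit.hom_ext h

/-- The map into a matching object with given components. -/
noncomputable def matchingLift {X : I ⥤ C} {i : I} {Y : C}
    (x : ∀ g : Boundary i, Y ⟶ X.obj g.obj.right)
    (hx : ∀ {g g' : Boundary i} (a : g ⟶ g'), x g ≫ X.map a.hom.right = x g') :
    Y ⟶ matchingObj X i :=
  limit.lift (boundaryDiagram X i)
    { pt := Y
      π :=
        { app := x
          naturality := fun _ _ a => (Category.id_comp _).trans (hx a).symm } }

theorem matchingLift_proj {X : I ⥤ C} {i : I} {Y : C}
    (x : ∀ g : Boundary i, Y ⟶ X.obj g.obj.right)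
    (hx : ∀ {g g' : Boundary i} (a : g ⟶ g'), x g ≫ X.map a.hom.right = x g') (g : Boundary i) :
    matchingLift x hx ≫ matchingProj X i g = x g :=
  limit.lift_π _ g

theorem matchingProj_map (X : I ⥤ C) (i : I) {g g' : Boundary i} (a : g ⟶ g') :
    matchingProj X i g ≫ X.map a.hom.right = matchingProj X i g' :=
  limit.w (boundaryDiagram X i) a

theorem relativeMatchingMap_fst {X Y : I ⥤ C} (p : X ⟶ Y) (i : I) :
    relativeMatchingMap p i ≫ pullback.fst _ _ = p.app i :=
  pullback.lift_fst _ _ _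

theorem relativeMatchingMap_snd {X Y : I ⥤ C} (p : X ⟶ Y) (i : I) :
    relativeMatchingMap p i ≫ pullback.snd _ _ = matchingMap X i :=
  pullback.lift_snd _ _ _

/-- A map `g : j ⟶ l`, as a map from `f : i ⟶ j` to the composite of `f` and `g`. -/
abbrev Under.toComp (f : Under i) (g : Under f.right) : f ⟶ Under.mk (f.hom ≫ g.hom) :=
  Under.homMk g.hom

omit [HasFiniteLimits C] [∀ i : I, Finite (Under i)] in
theorem Frame.comp_π_toComp {X : C} {t : X ⟶ T} {b : T ⟶ φ.base} {y : X ⟶ φ.E.obj f.right}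
    (w : t ≫ b ≫ φ.α f = y ≫ φ.π.app f.right) (g : Under f.right) :
    t ≫ b ≫ φ.α (Under.mk (f.hom ≫ g.hom)) = (y ≫ φ.E.map g.hom) ≫ φ.π.app g.right :=
  φ.comp_π w (Under.toComp f g)

/-- The component of a section at the continuation of `f : i ⟶ j` by `g : j ⟶ l`, restricted
along `E_j ⟶ E_l`. -/
def Sec.continuation (hf : IsCosieveStep S S' f) (σ : Sec k φ S' T) {X : C} (t : X ⟶ T)
    (y : X ⟶ φ.E.obj f.right) (w : t ≫ σ.base ≫ φ.α f = y ≫ φ.π.app f.right)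
    (g : Boundary f.right) : X ⟶ K.obj g.obj.right :=
  (σ.fam _ (hf.boundary g)).app t (y ≫ φ.E.map g.obj.hom) (Frame.comp_π_toComp w g.obj)

omit [HasFiniteLimits C] [∀ i : I, Finite (Under i)] in
theorem Sec.continuation_map (hf : IsCosieveStep S S' f) (σ : Sec k φ S' T) {X : C} (t : X ⟶ T)
    (y : X ⟶ φ.E.obj f.right) (w : t ≫ σ.base ≫ φ.α f = y ≫ φ.π.app f.right)
    {g g' : Boundary f.right} (a : g ⟶ g') :
    σ.continuation hf t y w g ≫ K.map a.hom.right = σ.continuation hf t y w g' := by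
  have ha : g.obj.hom ≫ a.hom.right = g'.obj.hom := Under.w a.hom
  let h : Under.mk (f.hom ≫ g.obj.hom) ⟶ Under.mk (f.hom ≫ g'.obj.hom) :=
    Under.homMk a.hom.right (by simp [ha])
  refine (σ.fam_map (hf.boundary g) (hf.boundary g') h _ _ _ (φ.comp_π
    (φ.comp_π w (Under.toComp f g.obj)) h)).trans ?_
  refine (σ.fam _ (hf.boundary g')).app_congr rfl ?_ _
  refine (Category.assoc _ _ _).trans (congr_arg (y ≫ ·) ?_)
  exact (φ.E.map_comp _ _).symm.trans (congr_arg (fun x => φ.E.map x) ha)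

omit [HasFiniteLimits C] [∀ i : I, Finite (Under i)] in
theorem Sec.continuation_comp (hf : IsCosieveStep S S' f) (σ : Sec k φ S' T) {X : C} (t : X ⟶ T)
    (y : X ⟶ φ.E.obj f.right) (w : t ≫ σ.base ≫ φ.α f = y ≫ φ.π.app f.right)
    (g : Boundary f.right) :
    σ.continuation hf t y w g ≫ k.app g.obj.right = (y ≫ φ.e f) ≫ B.map g.obj.hom :=
  (σ.fam_comp (hf.boundary g) _ _ _).trans ((Category.assoc _ _ _).trans
    ((congr_arg (y ≫ ·) (φ.e_map (Under.toComp f g.obj)).symm).trans (Category.assoc _ _ _).symm))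

omit [HasFiniteLimits C] [∀ i : I, Finite (Under i)] in
theorem Sec.comp_continuation (hf : IsCosieveStep S S' f) (σ : Sec k φ S' T) {X Y : C}
    (r : Y ⟶ X) (t : X ⟶ T)
    (y : X ⟶ φ.E.obj f.right) (w : t ≫ σ.base ≫ φ.α f = y ≫ φ.π.app f.right)
    (w' : (r ≫ t) ≫ σ.base ≫ φ.α f = (r ≫ y) ≫ φ.π.app f.right)
    (g : Boundary f.right) :
    r ≫ σ.continuation hf t y w g = σ.continuation hf (r ≫ t) (r ≫ y) w' g := by
  dsimp only [continuation]
  rw [FibMap.comp_app _ _ _ _ _ ((Frame.comp_π_toComp w' g.obj).trans (by simp))]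
  exact (σ.fam _ (hf.boundary g)).app_congr rfl (Category.assoc _ _ _).symm _

/-- The map `T ×_{D_j} E_j ⟶ B_j ×_{M_j B} M_j K` induced by a section over all proper
continuations of `f : i ⟶ j`. -/
noncomputable def Sec.stepMap (hf : IsCosieveStep S S' f) (σ : Sec k φ S' T) :
    FibMap (σ.base ≫ φ.α f) (φ.π.app f.right)
      (pullback (matchingMap B f.right) (matchingObjMap k f.right)) where
  app {X} t y w := pullback.lift (y ≫ φ.e f)
    (matchingLift (σ.continuation hf t y w) (σ.continuation_map hf t y w))
    (matchingObj_hom_ext fun g => by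
      rw [Category.assoc, Category.assoc, Category.assoc, matchingMap_proj, matchingObjMap_proj,
        reassoc_of% matchingLift_proj, continuation_comp, Category.assoc])
  comp_app r t y w w' := by
    apply pullback.hom_ext
    · rw [Category.assoc, pullback.lift_fst, pullback.lift_fst, Category.assoc]
    · rw [Category.assoc, pullback.lift_snd, pullback.lift_snd]
      refine matchingObj_hom_ext fun g => ?_
      rw [Category.assoc, matchingLift_proj, matchingLift_proj, comp_continuation]

theorem Sec.stepMap_app_fst (hf : IsCosieveStep S S' f) (σ : Sec k φ S' T) {X : C} (t : X ⟶ T)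
    (y : X ⟶ φ.E.obj f.right) (w : t ≫ σ.base ≫ φ.α f = y ≫ φ.π.app f.right) :
    (σ.stepMap hf).app t y w ≫ pullback.fst _ _ = y ≫ φ.e f :=
  pullback.lift_fst _ _ _

theorem Sec.stepMap_app_snd_proj (hf : IsCosieveStep S S' f) (σ : Sec k φ S' T) {X : C}
    (t : X ⟶ T) (y : X ⟶ φ.E.obj f.right) (w : t ≫ σ.base ≫ φ.α f = y ≫ φ.π.app f.right)
    (g : Boundary f.right) :
    (σ.stepMap hf).app t y w ≫ pullback.snd _ _ ≫ matchingProj K f.right g =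
      σ.continuation hf t y w g :=
  (Category.assoc _ _ _).symm.trans ((congr_arg (· ≫ _) (pullback.lift_snd _ _ _)).trans
    (matchingLift_proj _ _ g))

theorem Sec.eq_stepMap_app_iff (hf : IsCosieveStep S S' f) (σ : Sec k φ S' T)
    {X : C} (t : X ⟶ T) (y : X ⟶ φ.E.obj f.right)
    (w : t ≫ σ.base ≫ φ.α f = y ≫ φ.π.app f.right)
    (x : X ⟶ pullback (matchingMap B f.right) (matchingObjMap k f.right)) :
    x = (σ.stepMap hf).app t y w ↔
      x ≫ pullback.fst _ _ = y ≫ φ.e f ∧ ∀ g : Boundary f.right,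
        x ≫ pullback.snd _ _ ≫ matchingProj K f.right g = σ.continuation hf t y w g := by
  constructor
  · rintro rfl
    exact ⟨σ.stepMap_app_fst hf t y w, σ.stepMap_app_snd_proj hf t y w⟩
  · rintro ⟨h, h'⟩
    apply pullback.hom_ext
    · rw [h, stepMap_app_fst]
    · refine matchingObj_hom_ext fun g => ?_
      rw [Category.assoc, Category.assoc, h', stepMap_app_snd_proj]

/-- The two conditions on the right are what `fam_comp` and `fam_map` demand of a new component at
`f`. This is why extending a section by one map is a lifting problem against the relative matching
map. -/
theorem Sec.comp_relativeMatchingMap_eq_iff (hf : IsCosieveStep S S' f) (σ : Sec k φ S' T)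
    {X : C} (t : X ⟶ T) (y : X ⟶ φ.E.obj f.right)
    (w : t ≫ σ.base ≫ φ.α f = y ≫ φ.π.app f.right) (x : X ⟶ K.obj f.right) :
    x ≫ relativeMatchingMap k f.right = (σ.stepMap hf).app t y w ↔
      x ≫ k.app f.right = y ≫ φ.e f ∧ ∀ g : Boundary f.right,
        x ≫ K.map g.obj.hom = σ.continuation hf t y w g := by
  rw [eq_stepMap_app_iff, Category.assoc, relativeMatchingMap_fst]
  simp only [Category.assoc, reassoc_of% relativeMatchingMap_snd, matchingMap_proj]

/-- Extension of a section over `S'` to a section over `S`. -/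
noncomputable def Sec.extend (hf : IsCosieveStep S S' f) (σ : Sec k φ S' T)
    (u : FibMap (σ.base ≫ φ.α f) (φ.π.app f.right) (K.obj f.right))
    (hu : ∀ {X : C} (t : X ⟶ T) (y : X ⟶ φ.E.obj f.right)
      (w : t ≫ σ.base ≫ φ.α f = y ≫ φ.π.app f.right),
      u.app t y w ≫ relativeMatchingMap k f.right = (σ.stepMap hf).app t y w) :
    Sec k φ S T :=
  open Classical in
  { base := σ.base
    fam := fun h hh => if e : h = f then e ▸ u else σ.fam h (((hf.mem_iff h).1 hh).resolve_left e)
    fam_comp := fun {h} hh {X} t y w => by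
      by_cases e : h = f
      · subst e
        rw [dif_pos rfl]
        exact ((σ.comp_relativeMatchingMap_eq_iff hf _ _ _ _).1 (hu t y w)).1
      · rw [dif_neg e]
        exact σ.fam_comp _ _ _ _
    fam_map := fun {h h'} hh hh' a {X} t y w w' => by
      by_cases e : h = f
      · subst e
        by_cases e' : h' = h
        · subst e'
          obtain rfl := hf.endo a
          rw [dif_pos rfl]
          refine (congr_arg (_ ≫ ·) (K.map_id _)).trans ((Category.comp_id _).trans ?_)
          exact u.app_congr rfl ((Category.comp_id _).symm.trans
            (congr_arg (y ≫ ·) (φ.E.map_id _).symm)) _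
        -- A map from `f` to a different object lies over a non-identity map, so it indexes a
        -- projection of the matching object, and compatibility is that projection of the lifting
        -- equation.
        · rw [dif_pos rfl, dif_neg e']
          have hh₁ := ((hf.mem_iff h').1 hh').resolve_left e'
          have ha : ¬ MorphismProperty.identities I a.right :=
            fun ha => e' (Under.eq_of_identities a ha)
          have := ((σ.comp_relativeMatchingMap_eq_iff hf _ _ _ _).1 (hu t y w)).2
            (Boundary.mk a.right ha)
          exact this.trans (σ.fam_app_congr (Under.w a) _ hh₁ t rfl _ _)
      · have hh₁ := ((hf.mem_iff h).1 hh).resolve_left e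
        -- No map leads from `S'` to `f`, because `S'` is a cosieve that does not contain `f`.
        by_cases e' : h' = f
        · subst e'
          exact absurd (hf.closed hh₁ a) hf.notMem
        · rw [dif_neg e, dif_neg e']
          exact σ.fam_map _ _ a _ _ _ _ }

theorem Sec.extend_fam_self (hf : IsCosieveStep S S' f) (σ : Sec k φ S' T)
    (u : FibMap (σ.base ≫ φ.α f) (φ.π.app f.right) (K.obj f.right))
    (hu : ∀ {X : C} (t : X ⟶ T) (y : X ⟶ φ.E.obj f.right)
      (w : t ≫ σ.base ≫ φ.α f = y ≫ φ.π.app f.right),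
      u.app t y w ≫ relativeMatchingMap k f.right = (σ.stepMap hf).app t y w) :
    (σ.extend hf u hu).fam f hf.mem = u :=
  dif_pos rfl

theorem Sec.restrict_extend (hf : IsCosieveStep S S' f) (σ : Sec k φ S' T)
    (u : FibMap (σ.base ≫ φ.α f) (φ.π.app f.right) (K.obj f.right))
    (hu : ∀ {X : C} (t : X ⟶ T) (y : X ⟶ φ.E.obj f.right)
      (w : t ≫ σ.base ≫ φ.α f = y ≫ φ.π.app f.right),
      u.app t y w ≫ relativeMatchingMap k f.right = (σ.stepMap hf).app t y w) :
    (σ.extend hf u hu).restrict hf.subset = σ := by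
  refine Sec.ext' rfl fun h hh X t y w w' => ?_
  have : (σ.extend hf u hu).fam h (hf.subset hh) = σ.fam h hh :=
    dif_neg (by rintro rfl; exact hf.notMem hh)
  exact congr_arg (fun x => x.app t y w) this

/-- The map `β` is left free because, for a section pulled back along `a`, the composite `(a ≫ base)
≫ α f` agrees with the base of the given lift only after reassociation. -/
theorem Sec.exists_extend (hf : IsCosieveStep S S' f) (σ : Sec k φ S' T)
    {β : T ⟶ φ.D.obj f.right} (hβ : σ.base ≫ φ.α f = β)
    (u : FibMap β (φ.π.app f.right) (K.obj f.right))
    (hu : ∀ {X : C} (t : X ⟶ T) (y : X ⟶ φ.E.obj f.right) (w : t ≫ β = y ≫ φ.π.app f.right)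
      (w' : t ≫ σ.base ≫ φ.α f = y ≫ φ.π.app f.right),
      u.app t y w ≫ relativeMatchingMap k f.right = (σ.stepMap hf).app t y w') :
    ∃ τ : Sec k φ S T, τ.restrict hf.subset = σ ∧ ∀ {X : C} (t : X ⟶ T)
      (y : X ⟶ φ.E.obj f.right) (w : t ≫ τ.base ≫ φ.α f = y ≫ φ.π.app f.right)
      (w' : t ≫ β = y ≫ φ.π.app f.right), (τ.fam f hf.mem).app t y w = u.app t y w' := by
  subst hβ
  have hu' : ∀ {X : C} (t : X ⟶ T) (y : X ⟶ φ.E.obj f.right)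
      (w : t ≫ σ.base ≫ φ.α f = y ≫ φ.π.app f.right),
      u.app t y w ≫ relativeMatchingMap k f.right = (σ.stepMap hf).app t y w :=
    fun t y w => hu t y w w
  exact ⟨σ.extend hf u hu', σ.restrict_extend hf u hu', fun t y w w' =>
    congr_arg (fun x => x.app t y w') (σ.extend_fam_self hf u hu')⟩

omit [HasFiniteLimits C] [∀ i : I, Finite (Under i)] in
/-- Two sections over `S` are equal if they agree on `S'` and at `f`. -/
theorem Sec.ext_step (hf : IsCosieveStep S S' f) {σ τ : Sec k φ S T}
    (h : σ.restrict hf.subset = τ.restrict hf.subset)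
    (h' : ∀ {X : C} (t : X ⟶ T) (y : X ⟶ φ.E.obj f.right)
      (w : t ≫ σ.base ≫ φ.α f = y ≫ φ.π.app f.right)
      (w' : t ≫ τ.base ≫ φ.α f = y ≫ φ.π.app f.right),
      (σ.fam f hf.mem).app t y w = (τ.fam f hf.mem).app t y w') : σ = τ := by
  have hb : (σ.restrict hf.subset).base = (τ.restrict hf.subset).base := congr_arg Sec.base h
  refine Sec.ext' hb fun g hg X t y w w' => ?_
  rcases (hf.mem_iff g).1 hg with rfl | hg'
  · exact h' t y w w'
  · exact fam_congr h hg' rfl rfl w w'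

/-- The component at `f` of a section over `S` is a lift of the map induced by the restriction of
the section to `S'`. -/
theorem Sec.fam_comp_relativeMatchingMap (hf : IsCosieveStep S S' f) (σ : Sec k φ S T)
    {X : C} (t : X ⟶ T) (y : X ⟶ φ.E.obj f.right)
    (w : t ≫ σ.base ≫ φ.α f = y ≫ φ.π.app f.right) :
    (σ.fam f hf.mem).app t y w ≫ relativeMatchingMap k f.right =
      ((σ.restrict hf.subset).stepMap hf).app t y w :=
  ((σ.restrict hf.subset).comp_relativeMatchingMap_eq_iff hf t y w _).2
    ⟨σ.fam_comp _ _ _ _, fun g => σ.fam_map hf.mem (hf.subset (hf.boundary g))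
      (Under.toComp f g.obj) _ _ _ _⟩

theorem Sec.stepMap_congr (hf : IsCosieveStep S S' f) {σ τ : Sec k φ S' T} (h : σ = τ)
    {X : C} {t t' : X ⟶ T} {y y' : X ⟶ φ.E.obj f.right} (ht : t = t') (hy : y = y')
    (w : t ≫ σ.base ≫ φ.α f = y ≫ φ.π.app f.right)
    (w' : t' ≫ τ.base ≫ φ.α f = y' ≫ φ.π.app f.right) :
    (σ.stepMap hf).app t y w = (τ.stepMap hf).app t' y' w' := by
  subst h ht hy; rfl

omit [HasFiniteLimits C] [∀ i : I, Finite (Under i)] in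
theorem Sec.restrict_pull {S' S : Set (Under i)} (hS : S' ⊆ S) (σ : Sec k φ S T) {X : C}
    (a : X ⟶ T) : (σ.pull a).restrict hS = (σ.restrict hS).pull a := rfl

/-- If `σ'` is a universal section over `S'`, then the base of a universal section over `S` is a
universal lift over the base of `σ'`. -/
theorem Sec.IsUniversal.isUnivLift (hf : IsCosieveStep S S' f) {Q Q' : C} {σ : Sec k φ S Q}
    {σ' : Sec k φ S' Q'} (h : σ.IsUniversal) (h' : σ'.IsUniversal) (r : Q ⟶ Q')
    (hr : σ'.pull r = σ.restrict hf.subset) :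
    IsUnivLift (σ'.stepMap hf) (relativeMatchingMap k f.right) r
      ((σ.fam f hf.mem).cast (by
        rw [← Category.assoc]; exact congr_arg (· ≫ _) (congr_arg Sec.base hr).symm)) := by
  have hb : r ≫ σ'.base = σ.base := congr_arg Sec.base hr
  have hb' : ∀ {X Y : C} (s : Y ⟶ X) (t : X ⟶ Q), s ≫ (t ≫ σ.base) ≫ φ.α f =
    (s ≫ t) ≫ r ≫ σ'.base ≫ φ.α f := fun s t => by rw [reassoc_of% hb]; simp
  refine ⟨fun t y w => ?_, fun {X} a u hu => ?_, fun {X} t t' ht hs => ?_⟩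
  · have w₁ : t ≫ σ.base ≫ φ.α f = y ≫ φ.π.app f.right := by rw [← w, reassoc_of% hb]
    refine (σ.fam_comp_relativeMatchingMap hf t y w₁).trans ?_
    exact stepMap_congr hf hr.symm rfl rfl _ (by rw [← w]; simp)
  · obtain ⟨τ, hτ, hτ'⟩ := (σ'.pull a).exists_extend hf (Category.assoc _ _ _) u
      (fun t y w w' => hu t y w)
    obtain ⟨t, ht, -⟩ := h τ
    have hta : t ≫ r = a := h'.hom_ext (by rw [← pull_pull, hr, ← restrict_pull, ht, hτ])
    have hb₂ : τ.base = a ≫ σ'.base := congr_arg Sec.base hτ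
    refine ⟨t, hta, fun s y w w' => ?_⟩
    have w₁ : s ≫ (σ.pull t).base ≫ φ.α f = y ≫ φ.π.app f.right := (hb' s t).trans w
    have w₂ : s ≫ τ.base ≫ φ.α f = y ≫ φ.π.app f.right := by
      rw [hb₂, Category.assoc, w']
    exact (fam_congr ht hf.mem rfl rfl w₁ w₂).trans (hτ' s y w₂ w')
  · refine h.hom_ext (ext_step hf ?_ fun s y w w' => ?_)
    · rw [restrict_pull, restrict_pull, ← hr, pull_pull, pull_pull, ht]
    · exact hs s y ((hb' s t).symm.trans w) ((hb' s t').symm.trans w')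

/-- If `σ'` is a universal section over `S'`, then a universal lift over the base of `σ'` carries
a universal section over `S`. -/
theorem IsUnivLift.exists_isUniversal (hf : IsCosieveStep S S' f) {Q Q' : C} {σ' : Sec k φ S' Q'}
    (h' : σ'.IsUniversal) {r : Q ⟶ Q'}
    {ε : FibMap (r ≫ σ'.base ≫ φ.α f) (φ.π.app f.right) (K.obj f.right)}
    (h : IsUnivLift (σ'.stepMap hf) (relativeMatchingMap k f.right) r ε) :
    ∃ σ : Sec k φ S Q, σ.IsUniversal ∧ σ'.pull r = σ.restrict hf.subset := by
  obtain ⟨ρ, hσ, hfam⟩ := (σ'.pull r).exists_extend hf (Category.assoc _ _ _) ε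
    (fun t y w w' => h.fac t y w)
  have hbρ : ρ.base = r ≫ σ'.base := congr_arg Sec.base hσ
  refine ⟨ρ, fun X τ => ?_, hσ.symm⟩
  obtain ⟨a, ha, -⟩ := h' (τ.restrict hf.subset)
  have hb : a ≫ σ'.base = τ.base := congr_arg Sec.base ha
  obtain ⟨t, ht, ht'⟩ := h.exists_lift a ((τ.fam f hf.mem).cast (by
      rw [← Category.assoc]; exact congr_arg (· ≫ _) hb.symm)) (fun s y w => by
    refine (τ.fam_comp_relativeMatchingMap hf s y _).trans ?_
    exact Sec.stepMap_congr hf ha.symm rfl rfl _ (by rw [← w]; simp))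
  -- By `Sec.ext_step`, classifying `τ` splits into a condition over `S'`, handled by universality
  -- of `σ'`, and one at `f`, handled by the universal lift.
  have key : ∀ t : X ⟶ Q, ρ.pull t = τ ↔
      t ≫ r = a ∧ ∀ {T : C} (s : T ⟶ X) (y : T ⟶ φ.E.obj f.right)
        (w : (s ≫ t) ≫ r ≫ σ'.base ≫ φ.α f = y ≫ φ.π.app f.right)
        (w' : s ≫ τ.base ≫ φ.α f = y ≫ φ.π.app f.right),
        ε.app (s ≫ t) y w = (τ.fam f hf.mem).app s y w' := by
    intro t
    constructor
    · intro hτ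
      refine ⟨h'.hom_ext ?_, fun s y w w' => ?_⟩
      · rw [← Sec.pull_pull, ← hσ, ← Sec.restrict_pull, hτ, ha]
      · have w₁ : s ≫ (ρ.pull t).base ≫ φ.α f =
            y ≫ φ.π.app f.right := by
          rw [hτ, w']
        exact (hfam (s ≫ t) y (by rw [hbρ, ← w]; simp) w).symm.trans
          (Sec.fam_congr hτ hf.mem rfl rfl w₁ w')
    · rintro ⟨h₁, h₂⟩
      refine Sec.ext_step hf ?_ fun s y w w' => ?_
      · rw [Sec.restrict_pull, hσ, Sec.pull_pull, h₁, ha]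
      · have w₁ : (s ≫ t) ≫ r ≫ σ'.base ≫ φ.α f = y ≫ φ.π.app f.right := by
          rw [← w', ← hb, ← h₁]; simp
        exact (hfam (s ≫ t) y (by rw [hbρ, ← w₁]; simp) w₁).trans (h₂ s y w₁ w')
  refine ⟨t, (key t).2 ⟨ht, fun s y w w' => ht' s y w (by rw [← w', ← hb]; simp)⟩, fun t' h₁ => ?_⟩
  obtain ⟨h₂, h₃⟩ := (key t').1 h₁
  refine h.hom_ext _ _ (h₂.trans ht.symm) fun s y w w' => ?_
  have w₁ : s ≫ τ.base ≫ φ.α f = y ≫ φ.π.app f.right := by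
    rw [← w, ← hb, ← h₂]; simp
  rw [h₃ s y w w₁, ht' s y w' (by rw [← w₁, ← hb]; simp)]
  rfl

end Step

end Sections

/-! ### Cosieves of maps out of an object, and induction on them. -/

section Cosieves

variable {I : Type u₁} [Category.{v₁} I]

/-- A set of maps out of `i` is a cosieve if it is closed under postcomposition. -/
def IsCosieve {i : I} (S : Set (Under i)) : Prop :=
  ∀ ⦃h h' : Under i⦄, h ∈ S → (h ⟶ h') → h' ∈ S

theorem isCosieve_univ (i : I) : IsCosieve (Set.univ : Set (Under i)) := fun _ _ _ _ => trivial

theorem eq_id_of_identities {i : I} {f : i ⟶ i} (h : MorphismProperty.identities I f) :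
    f = 𝟙 i := by
  cases h
  rfl

theorem eq_of_identities {i j : I} {f : i ⟶ j} (h : MorphismProperty.identities I f) :
    i = j := by
  cases h
  rfl

theorem IsInverseCategory.endo_eq_id (hI : IsInverseCategory I) {i : I} {f : Under i}
    (a : f ⟶ f) : a = 𝟙 f := by
  obtain ⟨deg, hdeg⟩ := hI
  apply Under.UnderMorphism.ext
  by_contra h
  exact lt_irrefl _ (hdeg a.right fun h' => h (eq_id_of_identities h'))

/-- A non-identity map strictly lowers the degree, and no continuation can raise it back to `deg i`,
so the boundary is a cosieve. Adding the identity of `i` is the step from which relative matching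
maps arise. -/
theorem IsInverseCategory.isCosieveStep_univ (hI : IsInverseCategory I) (i : I) :
    IsCosieveStep Set.univ {f : Under i | boundaryProp i f} (Under.mk (𝟙 i)) where
  mem_iff h := by
    refine ⟨fun _ => or_iff_not_imp_right.2 fun hh => ?_, fun _ => trivial⟩
    exact Under.eq_of_identities (f := Under.mk (𝟙 i)) (Under.homMk h.hom) (not_not.1 hh)
  notMem h := h ⟨i⟩
  closed h h' hh a hh' := by
    obtain ⟨deg, hdeg⟩ := hI
    have h₁ : deg h.right < deg i := hdeg h.hom hh
    have h₂ : deg i = deg h'.right := congr_arg deg (eq_of_identities hh')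
    by_cases ha : MorphismProperty.identities I a.right
    · have := congr_arg deg (eq_of_identities ha)
      omega
    · have := hdeg a.right ha
      omega
  boundary g := by
    have hg := g.property
    change ¬ MorphismProperty.identities I (𝟙 i ≫ g.obj.hom)
    rw [Category.id_comp]
    exact hg
  endo := hI.endo_eq_id

/-- Every nonempty cosieve is obtained from a smaller one by adding a map. -/
theorem IsInverseCategory.exists_isCosieveStep (hI : IsInverseCategory I) {i : I}
    [Finite (Under i)] {S : Set (Under i)} (hS : IsCosieve S) (hne : S.Nonempty) :
    ∃ S' f, IsCosieveStep S S' f := by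
  obtain ⟨deg, hdeg⟩ := id hI
  -- With `f` of maximal target degree, no other element of `S` maps to `f`, so removing `f` leaves
  -- a cosieve; proper continuations of `f` have smaller target degree and remain.
  obtain ⟨f, hf, hmax⟩ := Set.exists_max_image S (fun f => deg f.right) S.toFinite hne
  refine ⟨S \ {f}, f, fun h => ?_, by simp, fun h h' hh a => ⟨hS hh.1 a, ?_⟩, fun g => ⟨?_, ?_⟩,
    hI.endo_eq_id⟩
  · by_cases e : h = f
    · simp [e, hf]
    · simp [e]
  · rintro rfl
    by_cases ha : MorphismProperty.identities I a.right
    · exact hh.2 (Under.eq_of_identities a ha).symm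
    · exact absurd (hdeg a.right ha) (hmax h hh.1).not_gt
  · exact hS hf (Under.toComp f g.obj)
  · intro h
    have h₁ : deg g.obj.right = deg f.right :=
      congr_arg (fun x : Under i => deg x.right) (Set.mem_singleton_iff.1 h)
    exact (hdeg g.obj.hom g.property).ne h₁

/-- Induction on cosieves. -/
theorem IsInverseCategory.cosieve_induction (hI : IsInverseCategory I) {i : I}
    [Finite (Under i)] {motive : Set (Under i) → Prop} (empty : motive ∅)
    (step : ∀ S S' f, IsCosieveStep S S' f → motive S' → motive S) (S : Set (Under i))
    (hS : IsCosieve S) : motive S := by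
  induction hn : S.ncard using Nat.strong_induction_on generalizing S with
  | _ n ih =>
    subst hn
    rcases S.eq_empty_or_nonempty with rfl | hne
    · exact empty
    · obtain ⟨S', f, hf⟩ := hI.exists_isCosieveStep hS hne
      exact step S S' f hf (ih _ (Set.ncard_lt_ncard ⟨hf.subset, fun h => hf.notMem (h hf.mem)⟩
        S.toFinite) S' hf.closed rfl)

end Cosieves

/-! ### Existence of universal sections; Reedy fibrations are levelwise fibrations. -/

section Existence

variable {I : Type u₁} [Category.{v₁} I] {C : Type u₂} [Category.{v₂} C] {B K : I ⥤ C}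
  {k : K ⟶ B} {i : I} {φ : Frame B i}

/-- The unique section over the empty cosieve with a given base. -/
@[simps]
def Sec.ofEmpty (k : K ⟶ B) (φ : Frame B i) {T : C} (b : T ⟶ φ.base) : Sec k φ ∅ T where
  base := b
  fam _ hf := hf.elim
  fam_comp hf := hf.elim
  fam_map hf := hf.elim

theorem Sec.isUniversal_ofEmpty (k : K ⟶ B) (φ : Frame B i) :
    (Sec.ofEmpty k φ (𝟙 φ.base)).IsUniversal := fun X τ =>
  ⟨τ.base, Sec.ext' (Category.comp_id _) fun _ hf => hf.elim, fun t ht => by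
    simpa using congr_arg Sec.base ht⟩

variable [HasFiniteLimits C] [∀ i : I, Finite (Under i)]

/-- Universal sections exist over any cosieve, and their bases are fibrations. -/
theorem exists_isUniversal (hI : IsInverseCategory I) {F : MorphismProperty C}
    [F.IsMultiplicative] [F.IsStableUnderBaseChange]
    (hF : FibrationsStableUnderPushforward F) (hk : IsReedyFibration F k)
    (hφ : ∀ j, F (φ.π.app j)) {S : Set (Under i)} (hS : IsCosieve S) :
    ∃ (Q : C) (σ : Sec k φ S Q), σ.IsUniversal ∧ F σ.base := by
  refine hI.cosieve_induction (motive := fun S => ∃ (Q : C) (σ : Sec k φ S Q),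
    σ.IsUniversal ∧ F σ.base) ?_ ?_ S hS
  · exact ⟨_, Sec.ofEmpty k φ (𝟙 _), Sec.isUniversal_ofEmpty k φ, F.id_mem _⟩
  · rintro S S' f hf ⟨Q', σ', h', hb'⟩
    obtain ⟨Q, r, ε, h⟩ := hF.exists_isUnivLift (hφ f.right) (σ'.stepMap hf) (hk f.right)
    obtain ⟨σ, hσ, hr⟩ := h.exists_isUniversal hf h'
    refine ⟨Q, σ, hσ, ?_⟩
    -- The base of the new section is one more fibration `r` stacked on the base already built.
    rw [← show r ≫ σ'.base = σ.base from congr_arg Sec.base hr]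
    exact F.comp_mem _ _ (h.fibration hF (hφ f.right) (hk f.right)) hb'

/-- The frame for which sections over all maps out of `i` are maps to `K_i`. -/
abbrev Frame.self (B : I ⥤ C) (i : I) : Frame B i where
  base := B.obj i
  D := B
  E := B
  π := 𝟙 B
  α f := B.map f.hom
  α_map h := by rw [← B.map_comp]; exact congr_arg (fun x => B.map x) (Under.w h)
  e _ := 𝟙 _
  e_map _ := by simp

-- A Yoneda argument: when `π` is the identity of `B`, a section over all maps out of `i` is
-- determined by its component at the identity. Its use is to derive levelwise fibrancy of `k` from
-- the general construction, without a separate induction.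
omit [HasFiniteLimits C] [∀ i : I, Finite (Under i)] in
theorem exists_isUniversal_self (k : K ⟶ B) (i : I) :
    ∃ σ : Sec k (Frame.self B i) Set.univ (K.obj i), σ.IsUniversal ∧ σ.base = k.app i := by
  let σ : Sec k (Frame.self B i) Set.univ (K.obj i) :=
    { base := k.app i
      fam := fun f _ =>
        { app := fun t _ _ => t ≫ K.map f.hom
          comp_app := fun _ _ _ _ _ => (Category.assoc _ _ _).symm }
      fam_comp := fun {f} _ {X} t y w => by
        dsimp only
        rw [Category.assoc, k.naturality]
        exact w
      fam_map := fun {f f'} _ _ h {X} t y w w' => by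
        dsimp only
        rw [Category.assoc, ← K.map_comp]
        exact congr_arg (fun x => t ≫ K.map x) (Under.w h) }
  refine ⟨σ, fun X τ => ?_, rfl⟩
  have w₀ : 𝟙 X ≫ τ.base ≫ B.map (𝟙 i) = τ.base ≫ 𝟙 (B.obj i) := by simp
  -- The classifying map is the identity component evaluated at the universal point, namely `𝟙 X`
  -- paired with the base.
  refine ⟨(τ.fam (Under.mk (𝟙 i)) trivial).app (𝟙 X) τ.base w₀, ?_, fun t ht => ?_⟩
  · refine Sec.ext' ((τ.fam_comp _ _ _ _).trans (Category.comp_id _)) fun f _ T s y w w' => ?_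
    have hy : s ≫ τ.base ≫ B.map f.hom = y := w'.trans (Category.comp_id _)
    let h : Under.mk (𝟙 i) ⟶ f := Under.homMk f.hom (Category.id_comp _)
    have w₁ : (s ≫ 𝟙 X) ≫ τ.base ≫ B.map (𝟙 i) = (s ≫ τ.base) ≫ 𝟙 (B.obj i) := by simp
    have e := τ.fam_map (f := Under.mk (𝟙 i)) (f' := f) trivial trivial h (s ≫ 𝟙 X) (s ≫ τ.base)
      w₁ (Frame.comp_π _ w₁ h)
    refine Eq.trans ?_ (e.trans ?_)
    · refine congr_arg (· ≫ K.map f.hom) ?_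
      exact (τ.fam _ _).comp_app s _ _ w₀ w₁
    · exact (τ.fam f trivial).app_congr (Category.comp_id _) ((Category.assoc _ _ _).trans hy) _
  · have w₁ : 𝟙 X ≫ (σ.pull t).base ≫ B.map (𝟙 i) = τ.base ≫ 𝟙 (B.obj i) := by rw [ht, w₀]
    refine Eq.trans ?_ (Sec.fam_congr ht (f := Under.mk (𝟙 i)) trivial rfl rfl w₁ w₀)
    refine (Category.comp_id t).symm.trans (congr (congr_arg _ (Category.id_comp t).symm)
      (K.map_id i).symm)

/-- Reedy fibrations are levelwise fibrations. -/
theorem IsReedyFibration.app (hI : IsInverseCategory I) {F : MorphismProperty C}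
    [F.IsMultiplicative] [F.IsStableUnderBaseChange]
    (hF : FibrationsStableUnderPushforward F) (hk : IsReedyFibration F k) (i : I) :
    F (k.app i) := by
  obtain ⟨σ, hσ, hb⟩ := exists_isUniversal_self k i
  obtain ⟨Q, τ, hτ, hτF⟩ := exists_isUniversal (φ := Frame.self B i) hI hF hk
    (fun j => F.id_mem _) (isCosieve_univ i)
  obtain ⟨t, ht, -⟩ := hτ σ
  have := hτ.isIso hσ ht
  rw [← hb, ← ht]
  exact (F.cancel_left_of_respectsIso t τ.base).2 hτF

end Existence

/-! ### The diagram of universal sections is the pushforward. -/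

section PushforwardDiagram

variable {I : Type u₁} [Category.{v₁} I] {C : Type u₂} [Category.{v₂} C] {A B K : I ⥤ C}

/-- The frame at `i` for which universal sections compute the value at `i` of pushforwards
along `p`. -/
abbrev Frame.push (p : B ⟶ A) (i : I) : Frame B i where
  base := A.obj i
  D := A
  E := B
  π := p
  α f := A.map f.hom
  α_map h := by rw [← A.map_comp]; exact congr_arg (fun x => A.map x) (Under.w h)
  e _ := 𝟙 _
  e_map _ := by simp

variable {p : B ⟶ A} {k : K ⟶ B}

/-- The section at `j` obtained from a section at `i` and a map `g : i ⟶ j`. -/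
def Sec.push {i j : I} {S : Set (Under i)} {T : C} (σ : Sec k (Frame.push p i) S T) (g : i ⟶ j)
    (hg : ∀ f : Under j, Under.mk (g ≫ f.hom) ∈ S) : Sec k (Frame.push p j) Set.univ T where
  base := σ.base ≫ A.map g
  fam f _ := FibMap.cast (σ.fam (Under.mk (g ≫ f.hom)) (hg f)) (by simp)
  fam_comp {f} _ _ _ _ _ := σ.fam_comp (hg f) _ _ _
  fam_map {f f'} _ _ h {X} t y w w' := by
    let h' : Under.mk (g ≫ f.hom) ⟶ Under.mk (g ≫ f'.hom) :=
      Under.homMk h.right ((Category.assoc _ _ _).trans (congr_arg (g ≫ ·) (Under.w h)))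
    exact σ.fam_map (hg f) (hg f') h' _ _ _ _

theorem Sec.push_pull {i j : I} {S : Set (Under i)} {T : C} (σ : Sec k (Frame.push p i) S T)
    (g : i ⟶ j) (hg : ∀ f : Under j, Under.mk (g ≫ f.hom) ∈ S) {X : C} (a : X ⟶ T) :
    (σ.pull a).push g hg = (σ.push g hg).pull a :=
  Sec.ext' (Category.assoc _ _ _) fun _ _ _ _ _ _ _ => rfl

theorem Sec.push_push {i j l : I} {S : Set (Under i)} {T : C} (σ : Sec k (Frame.push p i) S T)
    (g : i ⟶ j) (hg : ∀ f : Under j, Under.mk (g ≫ f.hom) ∈ S) (g' : j ⟶ l)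
    (hg' : ∀ f : Under l, Under.mk ((g ≫ g') ≫ f.hom) ∈ S) :
    (σ.push g hg).push g' (fun _ => Set.mem_univ _) = σ.push (g ≫ g') hg' := by
  refine Sec.ext' ((Category.assoc _ _ _).trans (congr_arg (σ.base ≫ ·) (A.map_comp _ _).symm))
    fun f _ X t y w w' => ?_
  exact σ.fam_app_congr (Category.assoc _ _ _).symm _ _ _ rfl _ _

theorem Sec.push_id {i : I} {T : C} (σ : Sec k (Frame.push p i) Set.univ T) :
    σ.push (𝟙 i) (fun _ => Set.mem_univ _) = σ := by
  refine Sec.ext' ((congr_arg (σ.base ≫ ·) (A.map_id _)).trans (Category.comp_id _))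
    fun f _ X t y w w' => ?_
  exact σ.fam_app_congr (Category.id_comp _) _ _ _ rfl _ _

variable (p k) in
/-- Compatible universal sections with domains the values of a diagram. -/
structure UniversalSections (P : I ⥤ C) where
  sec (i : I) : Sec k (Frame.push p i) Set.univ (P.obj i)
  isUniversal (i : I) : (sec i).IsUniversal
  push_sec {i j : I} (g : i ⟶ j) : (sec i).push g (fun _ => Set.mem_univ _) = (sec j).pull (P.map g)

namespace UniversalSections

/-- The projection to the target of `p`. -/
@[simps]
def proj {P : I ⥤ C} (σ : UniversalSections p k P) : P ⟶ A where
  app i := (σ.sec i).base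
  naturality _ _ g := (congr_arg Sec.base (σ.push_sec g)).symm

/-- Transport along an isomorphism of diagrams. -/
def ofIso {P P' : I ⥤ C} (σ : UniversalSections p k P) (a : P' ⟶ P) [∀ i, IsIso (a.app i)] :
    UniversalSections p k P' where
  sec i := (σ.sec i).pull (a.app i)
  isUniversal i := (σ.isUniversal i).of_isIso _
  push_sec g := by
    rw [Sec.push_pull, σ.push_sec, Sec.pull_pull, Sec.pull_pull, a.naturality]

/-- Universal sections are the values of a diagram. -/
theorem exists_of_isUniversal
    (h : ∀ i, ∃ (Q : C) (σ : Sec k (Frame.push p i) Set.univ Q), σ.IsUniversal) :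
    ∃ P : I ⥤ C, Nonempty (UniversalSections p k P) := by
  choose Q σ hσ using h
  -- The transition map along `g` classifies the section reindexed along `g`; uniqueness of
  -- classifying maps gives functoriality.
  choose m hm _ using fun (i j : I) (g : i ⟶ j) => hσ j ((σ i).push g fun _ => Set.mem_univ _)
  dsimp only at hm
  let P : I ⥤ C :=
    { obj := Q
      map := fun {i j} g => m i j g
      map_id := fun i => (hσ i).hom_ext (by rw [hm, Sec.push_id, Sec.pull_id])
      map_comp := fun {i j l} g g' => (hσ l).hom_ext (by
        rw [hm, ← Sec.pull_pull, hm, ← Sec.push_pull, hm, Sec.push_push]) }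
  exact ⟨P, ⟨σ, hσ, fun {i j} g => (hm i j g).symm⟩⟩

end UniversalSections

variable [HasPullbacks C]

theorem isPullback_app {X : I ⥤ C} (a : X ⟶ A) (p : B ⟶ A) (i : I) :
    IsPullback ((pullback.fst a p).app i) ((pullback.snd a p).app i) (a.app i) (p.app i) :=
  (IsPullback.of_hasPullback a p).map ((evaluation I C).obj i)

/-- The sections corresponding to a map `p^* X ⟶ K` over `B`. -/
noncomputable def Sec.ofHom {X : I ⥤ C} {a : X ⟶ A} (v : pullback a p ⟶ K)
    (hv : v ≫ k = pullback.snd a p) (i : I) :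
    Sec k (Frame.push p i) Set.univ (X.obj i) where
  base := a.app i
  fam f _ :=
    { app := fun t y w => (isPullback_app a p f.right).lift (t ≫ X.map f.hom) y
        (by rw [Category.assoc, ← w]; simp) ≫ v.app f.right
      comp_app := fun r t y w w' => by
        rw [← Category.assoc]
        congr 1
        apply (isPullback_app a p f.right).hom_ext <;> simp }
  fam_comp {f} _ {T} t y w := by
    have : v.app f.right ≫ k.app f.right = (pullback.snd a p).app f.right := by
      rw [← hv]; rfl
    dsimp only
    rw [Category.assoc, this, IsPullback.lift_snd]
    exact (Category.comp_id _).symm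
  fam_map {f f'} _ _ h {T} t y w w' := by
    dsimp only
    rw [Category.assoc, ← v.naturality, ← Category.assoc]
    congr 1
    apply (isPullback_app a p f'.right).hom_ext
    · rw [Category.assoc, (pullback.fst a p).naturality, IsPullback.lift_fst_assoc,
        IsPullback.lift_fst, Category.assoc, ← X.map_comp]
      exact congr_arg (fun x => t ≫ X.map x) (Under.w h)
    · rw [Category.assoc, (pullback.snd a p).naturality, IsPullback.lift_snd_assoc,
        IsPullback.lift_snd]

theorem Sec.push_ofHom {X : I ⥤ C} {a : X ⟶ A} (v : pullback a p ⟶ K)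
    (hv : v ≫ k = pullback.snd a p) {i j : I} (g : i ⟶ j) :
    (Sec.ofHom v hv i).push g (fun _ => Set.mem_univ _) = (Sec.ofHom v hv j).pull (X.map g) := by
  refine Sec.ext' (a.naturality g).symm fun f _ T t y w w' => ?_
  refine congr_arg (· ≫ v.app f.right) ((isPullback_app a p f.right).hom_ext ?_ ?_)
  · refine (IsPullback.lift_fst _ _ _ _).trans (Eq.trans ?_ (IsPullback.lift_fst _ _ _ _).symm)
    exact (congr_arg (t ≫ ·) (X.map_comp _ _)).trans (Category.assoc _ _ _).symm
  · exact (IsPullback.lift_snd _ _ _ _).trans (IsPullback.lift_snd _ _ _ _).symm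

theorem Sec.ofHom_injective {X : I ⥤ C} {a : X ⟶ A} {v v' : pullback a p ⟶ K}
    {hv : v ≫ k = pullback.snd a p} {hv' : v' ≫ k = pullback.snd a p}
    (h : ∀ i, Sec.ofHom v hv i = Sec.ofHom v' hv' i) : v = v' := by
  ext i
  have w : (pullback.fst a p).app i ≫ a.app i ≫ A.map (𝟙 i) =
    (pullback.snd a p).app i ≫ p.app i := by simpa using (isPullback_app a p i).w
  have w₀ : ((pullback.fst a p).app i ≫ X.map (𝟙 i)) ≫ a.app i =
    (pullback.snd a p).app i ≫ p.app i := by simpa using w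
  have e : (isPullback_app a p i).lift _ _ w₀ ≫ v.app i =
      (isPullback_app a p i).lift _ _ w₀ ≫ v'.app i :=
    Sec.fam_congr (h i) (f := Under.mk (𝟙 i)) trivial rfl rfl w w
  have e' : (isPullback_app a p i).lift _ _ w₀ = 𝟙 _ := by
    apply (isPullback_app a p i).hom_ext <;> simp
  rwa [e', Category.id_comp, Category.id_comp] at e

theorem Sec.ofHom_comp {X P : I ⥤ C} {a : X ⟶ A} {q : P ⟶ A} (v : pullback q p ⟶ K)
    (hv : v ≫ k = pullback.snd q p) (t : X ⟶ P) (ht : t ≫ q = a) (l : pullback a p ⟶ pullback q p)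
    (hl₁ : l ≫ pullback.fst q p = pullback.fst a p ≫ t)
    (hl₂ : l ≫ pullback.snd q p = pullback.snd a p) (hv' : (l ≫ v) ≫ k = pullback.snd a p)
    (i : I) : Sec.ofHom (l ≫ v) hv' i = (Sec.ofHom v hv i).pull (t.app i) := by
  refine Sec.ext' (congr_app ht i).symm fun f _ T s y w w' => ?_
  refine (Category.assoc _ _ _).symm.trans (congr_arg (· ≫ v.app f.right) ?_)
  have e₁ : l.app f.right ≫ (pullback.fst q p).app f.right =
    (pullback.fst a p).app f.right ≫ t.app f.right := congr_app hl₁ f.right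
  have e₂ : l.app f.right ≫ (pullback.snd q p).app f.right = (pullback.snd a p).app f.right :=
    congr_app hl₂ f.right
  apply (isPullback_app q p f.right).hom_ext
  · refine Eq.trans ?_ (IsPullback.lift_fst _ _ _ _).symm
    rw [Category.assoc, e₁]
    refine (Category.assoc _ _ _).symm.trans ((congr_arg (· ≫ t.app f.right)
      (IsPullback.lift_fst _ _ _ _)).trans ?_)
    rw [Category.assoc, Category.assoc, t.naturality]
  · refine Eq.trans ?_ (IsPullback.lift_snd _ _ _ _).symm
    rw [Category.assoc, e₂]
    exact IsPullback.lift_snd _ _ _ _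

namespace UniversalSections

variable {P : I ⥤ C} (σ : UniversalSections p k P)

-- Compatibility with reindexing makes every component of a universal section come from an identity
-- component at another object. Hence the evaluation map, which uses only identity components, loses
-- no information.
omit [HasPullbacks C] in
theorem fam_id_app {i j : I} (g : i ⟶ j) {T : C} (t : T ⟶ P.obj i) (y : T ⟶ B.obj j)
    (w : (t ≫ P.map g) ≫ (σ.sec j).base ≫ A.map (𝟙 j) = y ≫ p.app j)
    (w' : t ≫ (σ.sec i).base ≫ A.map g = y ≫ p.app j) :
    ((σ.sec j).fam (Under.mk (𝟙 j)) trivial).app (t ≫ P.map g) y w =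
      ((σ.sec i).fam (Under.mk g) trivial).app t y w' := by
  have w₁ : t ≫ ((σ.sec j).pull (P.map g)).base ≫ A.map (𝟙 j) = y ≫ p.app j := by
    simpa using w
  have w₂ : t ≫ ((σ.sec i).push g fun _ => Set.mem_univ _).base ≫ A.map (𝟙 j) = y ≫ p.app j := by
    rw [σ.push_sec, w₁]
  refine (Sec.fam_congr (σ.push_sec g) (f := Under.mk (𝟙 j)) trivial rfl rfl w₂ w₁).symm.trans ?_
  exact (σ.sec i).fam_app_congr (Category.comp_id g) _ _ t rfl _ _

/-- The evaluation map `p^* P ⟶ K`. -/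
noncomputable def evHom : pullback σ.proj p ⟶ K where
  app i := ((σ.sec i).fam (Under.mk (𝟙 i)) trivial).app ((pullback.fst σ.proj p).app i)
    ((pullback.snd σ.proj p).app i) (by simpa using (isPullback_app σ.proj p i).w)
  naturality i j g := by
    have w : (pullback.fst σ.proj p).app i ≫ (σ.sec i).base ≫ A.map (𝟙 i) =
      (pullback.snd σ.proj p).app i ≫ p.app i := by simpa using (isPullback_app σ.proj p i).w
    have w₀ : (pullback.fst σ.proj p).app j ≫ (σ.sec j).base ≫ A.map (𝟙 j) =
      (pullback.snd σ.proj p).app j ≫ p.app j := by simpa using (isPullback_app σ.proj p j).w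
    let h : Under.mk (𝟙 i) ⟶ Under.mk g := Under.homMk g (Category.id_comp _)
    have w' := Frame.comp_π _ w h
    have w'' : ((pullback.fst σ.proj p).app i ≫ P.map g) ≫ (σ.sec j).base ≫ A.map (𝟙 j) =
        ((pullback.snd σ.proj p).app i ≫ B.map g) ≫ p.app j := by
      rw [← (pullback.fst σ.proj p).naturality, ← (pullback.snd σ.proj p).naturality,
        Category.assoc, Category.assoc, w₀]
    refine Eq.trans ?_ ((σ.fam_id_app g _ _ w'' w').trans
      ((σ.sec i).fam_map (f := Under.mk (𝟙 i)) (f' := Under.mk g) trivial trivial h _ _ w w').symm)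
    refine (FibMap.comp_app _ ((pullback σ.proj p).map g) _ _ w₀ ((Category.assoc _ _ _).trans
      ((congr_arg (_ ≫ ·) w₀).trans (Category.assoc _ _ _).symm))).trans ?_
    exact FibMap.app_congr _ ((pullback.fst σ.proj p).naturality g)
      ((pullback.snd σ.proj p).naturality g) _

theorem evHom_comp : σ.evHom ≫ k = pullback.snd σ.proj p := by
  ext i
  exact ((σ.sec i).fam_comp _ _ _ _).trans (Category.comp_id _)

theorem ofHom_evHom (i : I) : Sec.ofHom σ.evHom σ.evHom_comp i = σ.sec i := by
  refine Sec.ext' rfl fun f _ T t y w w' => ?_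
  have w₀ : (pullback.fst σ.proj p).app f.right ≫ (σ.sec f.right).base ≫ A.map (𝟙 f.right) =
    (pullback.snd σ.proj p).app f.right ≫ p.app f.right := by
      simpa using (isPullback_app σ.proj p f.right).w
  have w₁ : (t ≫ P.map f.hom) ≫ (σ.sec f.right).base ≫ A.map (𝟙 f.right) =
      y ≫ p.app f.right := by
    refine Eq.trans ?_ w
    have := congr_arg Sec.base (σ.push_sec f.hom)
    dsimp only [Sec.push, Sec.pull] at this
    rw [A.map_id, Category.comp_id, Category.assoc]
    exact congr_arg (t ≫ ·) this.symm
  have w₂ : (t ≫ P.map f.hom) ≫ σ.proj.app f.right = y ≫ p.app f.right := by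
    simpa using w₁
  refine Eq.trans ?_ (σ.fam_id_app f.hom t y w₁ w')
  refine (FibMap.comp_app _ ((isPullback_app σ.proj p f.right).lift (t ≫ P.map f.hom) y w₂) _ _
    w₀ (by rw [IsPullback.lift_fst, IsPullback.lift_snd]; exact w₁)).trans ?_
  exact FibMap.app_congr _ (IsPullback.lift_fst _ _ _ _) (IsPullback.lift_snd _ _ _ _) _

/-- The evaluation map over `B`. -/
noncomputable def ev : (Over.pullback p).obj (Over.mk σ.proj) ⟶ Over.mk k :=
  Over.homMk σ.evHom σ.evHom_comp

/-- A diagram of universal sections is a pushforward. -/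
theorem isPushforward : IsPushforward p (Over.mk k) (Over.mk σ.proj) σ.ev := by
  intro X u
  have hu : u.left ≫ k = pullback.snd X.hom p := Over.w u
  -- The transpose of `u` is found levelwise: at `i` it classifies the section whose components are
  -- those of `u`.
  choose m hm _ using fun i => σ.isUniversal i (Sec.ofHom u.left hu i)
  dsimp only at hm
  let t : X.left ⟶ P :=
    { app := m
      naturality := fun i j g => (σ.isUniversal j).hom_ext (by
        rw [← Sec.pull_pull, ← Sec.pull_pull, hm, ← σ.push_sec, ← Sec.push_pull, hm,
          Sec.push_ofHom]) }
  have key : ∀ t : X ⟶ Over.mk σ.proj, (Over.pullback p).map t ≫ σ.ev = u ↔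
      ∀ i, (σ.sec i).pull (t.left.app i) = Sec.ofHom u.left hu i := by
    intro t
    let l : pullback X.hom p ⟶ pullback σ.proj p := ((Over.pullback p).map t).left
    have hl₁ : l ≫ pullback.fst σ.proj p = pullback.fst X.hom p ≫ t.left := pullback.lift_fst _ _ _
    have hl₂ : l ≫ pullback.snd σ.proj p = pullback.snd X.hom p := pullback.lift_snd _ _ _
    have hv' : (l ≫ σ.evHom) ≫ k = pullback.snd X.hom p := by
      rw [Category.assoc, evHom_comp, hl₂]
    have e : ∀ i, Sec.ofHom (l ≫ σ.evHom) hv' i = (σ.sec i).pull (t.left.app i) := fun i => by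
      rw [Sec.ofHom_comp σ.evHom σ.evHom_comp t.left (Over.w t) l hl₁ hl₂ hv' i, ofHom_evHom]
    constructor
    · intro h i
      have h' : l ≫ σ.evHom = u.left := congr_arg (fun x => x.left) h
      rw [← e]
      congr 1
    · intro h
      apply Over.OverMorphism.ext
      exact Sec.ofHom_injective (hv := hv') (hv' := hu) fun i => (e i).trans (h i)
  have ht : t ≫ σ.proj = X.hom := by
    ext i
    exact congr_arg Sec.base (hm i)
  refine ⟨Over.homMk t ht, (key _).2 hm, fun t' ht' => ?_⟩
  apply Over.OverMorphism.ext
  ext i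
  exact (σ.isUniversal i).hom_ext (((key t').1 ht' i).trans (hm i).symm)

/-- Every pushforward carries universal sections. -/
theorem exists_of_isPushforward (σ : UniversalSections p k P) {Q : Over A}
    {ev : (Over.pullback p).obj Q ⟶ Over.mk k}
    (h : IsPushforward p (Over.mk k) Q ev) :
    ∃ τ : UniversalSections p k Q.left, τ.proj = Q.hom := by
  obtain ⟨t, ht, -⟩ := σ.isPushforward Q ev
  obtain ⟨s, hs, -⟩ := h (Over.mk σ.proj) σ.ev
  have h₁ : t ≫ s = 𝟙 _ := (h Q ev).unique
    (by rw [Functor.map_comp, Category.assoc, hs, ht])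
    (by rw [CategoryTheory.Functor.map_id, Category.id_comp])
  have h₂ : s ≫ t = 𝟙 _ := (σ.isPushforward _ σ.ev).unique
    (by rw [Functor.map_comp, Category.assoc, ht, hs])
    (by rw [CategoryTheory.Functor.map_id, Category.id_comp])
  have h₁' : t.left ≫ s.left = 𝟙 _ := congr_arg (fun x => x.left) h₁
  have h₂' : s.left ≫ t.left = 𝟙 _ := congr_arg (fun x => x.left) h₂
  have : ∀ i, IsIso (t.left.app i) := fun i =>
    ⟨s.left.app i, congr_app h₁' i, congr_app h₂' i⟩
  exact ⟨σ.ofIso t.left, Over.w t⟩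

end UniversalSections

end PushforwardDiagram

/-! ### Relative matching maps of the pushforward. -/

section ReedyPushforward

variable {I : Type u₁} [Category.{v₁} I] {C : Type u₂} [Category.{v₂} C] {A B K P : I ⥤ C}
  {p : B ⟶ A} {k : K ⟶ B}

theorem IsInverseCategory.comp_mem_boundary (hI : IsInverseCategory I) {i : I} (g : Boundary i)
    (f : Under g.obj.right) : Under.mk (g.obj.hom ≫ f.hom) ∈ {f : Under i | boundaryProp i f} :=
  (hI.isCosieveStep_univ i).closed g.property (Under.toComp g.obj f)

theorem Sec.push_congr {i j : I} {S : Set (Under i)} {T : C} (σ : Sec k (Frame.push p i) S T)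
    {g g' : i ⟶ j} (h : g = g') (hg : ∀ f : Under j, Under.mk (g ≫ f.hom) ∈ S)
    (hg' : ∀ f : Under j, Under.mk (g' ≫ f.hom) ∈ S) : σ.push g hg = σ.push g' hg' := by
  subst h; rfl

/-- Sections over the boundary are determined by the sections obtained from them at the targets
of non-identity maps. -/
theorem Sec.ext_push (hI : IsInverseCategory I) {i : I} {T : C}
    {σ τ : Sec k (Frame.push p i) {f : Under i | boundaryProp i f} T} (hb : σ.base = τ.base)
    (h : ∀ g : Boundary i, σ.push g.obj.hom (hI.comp_mem_boundary g) =
      τ.push g.obj.hom (hI.comp_mem_boundary g)) : σ = τ := by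
  refine Sec.ext' hb fun f hf X t y w w' => ?_
  have e : ∀ σ : Sec k (Frame.push p i) {f : Under i | boundaryProp i f} T,
      t ≫ σ.base ≫ A.map f.hom = y ≫ p.app f.right →
      t ≫ (σ.push f.hom (hI.comp_mem_boundary ⟨f, hf⟩)).base ≫ A.map (𝟙 f.right) =
        y ≫ p.app f.right := fun σ w => by
    rw [A.map_id, Category.comp_id]; exact w
  refine Eq.trans ?_ ((Sec.fam_congr (h ⟨f, hf⟩) (f := Under.mk (𝟙 f.right)) trivial rfl rfl
    (e σ w) (e τ w')).trans ?_)
  · exact σ.fam_app_congr (Category.comp_id _).symm _ _ t rfl _ _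
  · exact τ.fam_app_congr (Category.comp_id _) _ _ t rfl _ _

variable [HasFiniteLimits C] [∀ i : I, Finite (Under i)]

namespace UniversalSections

variable (σ : UniversalSections p k P)

/-- The projection `A_i ×_{M_i A} M_i P ⟶ P_j` at a non-identity map `i ⟶ j`. -/
noncomputable def matchingFst (i : I) (g : Boundary i) :
    pullback (matchingMap A i) (matchingObjMap σ.proj i) ⟶ P.obj g.obj.right :=
  pullback.snd _ _ ≫ matchingProj P i g

theorem matchingFst_map (i : I) {g g' : Boundary i} (a : g ⟶ g') :
    σ.matchingFst i g ≫ P.map a.hom.right = σ.matchingFst i g' := by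
  rw [matchingFst, Category.assoc, matchingProj_map]; rfl

theorem matchingFst_base (i : I) (g : Boundary i) :
    σ.matchingFst i g ≫ (σ.sec g.obj.right).base = pullback.fst _ _ ≫ A.map g.obj.hom := by
  have h := matchingObjMap_proj σ.proj i g
  rw [← matchingMap_proj, pullback.condition_assoc, h, matchingFst, Category.assoc]
  rfl

/-- The section over the boundary with domain `A_i ×_{M_i A} M_i P`. -/
noncomputable def boundarySec (i : I) :
    Sec k (Frame.push p i) {f : Under i | boundaryProp i f}
      (pullback (matchingMap A i) (matchingObjMap σ.proj i)) where
  base := pullback.fst _ _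
  fam f hf := (((σ.sec f.right).fam (Under.mk (𝟙 f.right)) trivial).pull
    (σ.matchingFst i ⟨f, hf⟩)).cast ((congr_arg (_ ≫ ·)
      ((congr_arg ((σ.sec f.right).base ≫ ·) (A.map_id _)).trans (Category.comp_id _))).trans
        (σ.matchingFst_base i ⟨f, hf⟩))
  fam_comp {f} hf {T} t y w := (σ.sec f.right).fam_comp trivial _ _ _
  fam_map {f f'} hf hf' h {T} t y w w' := by
    let x := t ≫ σ.matchingFst i ⟨f, hf⟩
    let h' : Under.mk (𝟙 f.right) ⟶ Under.mk h.right := Under.homMk h.right (Category.id_comp _)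
    have hx : x ≫ (σ.sec f.right).base = t ≫ pullback.fst _ _ ≫ A.map f.hom := by
      rw [Category.assoc, matchingFst_base]
    have w₁ : x ≫ (σ.sec f.right).base ≫ A.map (𝟙 f.right) = y ≫ p.app f.right := by
      rw [A.map_id, Category.comp_id, hx]
      exact w
    have w₂ := Frame.comp_π _ w₁ h'
    have w₃ : (x ≫ P.map h.right) ≫ (σ.sec f'.right).base ≫ A.map (𝟙 f'.right) =
        (y ≫ B.map h.right) ≫ p.app f'.right := by
      refine Eq.trans ?_ w₂
      rw [A.map_id, Category.comp_id, Category.assoc]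
      exact congr_arg (x ≫ ·) (congr_arg Sec.base (σ.push_sec h.right)).symm
    refine ((σ.sec f.right).fam_map (f := Under.mk (𝟙 f.right)) (f' := Under.mk h.right) trivial
      trivial h' x y w₁ w₂).trans ((σ.fam_id_app h.right x (y ≫ B.map h.right) w₃ w₂).symm.trans ?_)
    refine FibMap.app_congr _ ((Category.assoc _ _ _).trans (congr_arg (t ≫ ·) ?_)) rfl _
    exact σ.matchingFst_map i (g := ⟨f, hf⟩) (g' := ⟨f', hf'⟩) (ObjectProperty.homMk h)

theorem push_boundarySec (hI : IsInverseCategory I) (i : I) (g : Boundary i) :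
    (σ.boundarySec i).push g.obj.hom (hI.comp_mem_boundary g) =
      (σ.sec g.obj.right).pull (σ.matchingFst i g) := by
  refine Sec.ext' (σ.matchingFst_base i g).symm fun f _ T t y w w' => ?_
  have w₁ : (t ≫ σ.matchingFst i g) ≫ (σ.sec g.obj.right).base ≫ A.map f.hom =
    y ≫ p.app f.right := by
      rw [← Category.assoc, Category.assoc t]
      exact (Category.assoc _ _ _).trans w'
  have w₂ : ((t ≫ σ.matchingFst i g) ≫ P.map f.hom) ≫ (σ.sec f.right).base ≫ A.map (𝟙 f.right) =
      y ≫ p.app f.right := by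
    refine Eq.trans ?_ w₁
    rw [A.map_id, Category.comp_id, Category.assoc]
    exact congr_arg (_ ≫ ·) (congr_arg Sec.base (σ.push_sec f.hom)).symm
  refine Eq.trans ?_ (σ.fam_id_app f.hom (t ≫ σ.matchingFst i g) y w₂ w₁)
  refine FibMap.app_congr _ (Eq.trans (congr_arg (t ≫ ·) ?_) (Category.assoc _ _ _).symm) rfl _
  exact (σ.matchingFst_map i (g := g) (g' := ⟨_, hI.comp_mem_boundary g f⟩)
    (ObjectProperty.homMk (Under.toComp g.obj f))).symm

/-- This identifies the classifying map from `P_i` to the universal boundary object as the relative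
matching map, so the general step from `S'` to `S` applies to it. -/
theorem pull_boundarySec (hI : IsInverseCategory I) (i : I) :
    (σ.boundarySec i).pull (relativeMatchingMap σ.proj i) =
      (σ.sec i).restrict (hI.isCosieveStep_univ i).subset := by
  refine Sec.ext_push hI (relativeMatchingMap_fst σ.proj i) fun g => ?_
  have : relativeMatchingMap σ.proj i ≫ σ.matchingFst i g = P.map g.obj.hom := by
    rw [matchingFst, reassoc_of% relativeMatchingMap_snd, matchingMap_proj]
  rw [Sec.push_pull, push_boundarySec σ hI, Sec.pull_pull, this, ← σ.push_sec]
  rfl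

/-- Reindexing a boundary section along each non-identity `g : i ⟶ j` gives a full section at `j`,
classified by a map to `P_j`. These maps are compatible, hence amount to a map to `M_i P`; the base
supplies the component in `A_i`. -/
theorem isUniversal_boundarySec (hI : IsInverseCategory I) (i : I) :
    (σ.boundarySec i).IsUniversal := by
  intro X τ
  choose m hm _ using fun g : Boundary i =>
    σ.isUniversal g.obj.right (τ.push g.obj.hom (hI.comp_mem_boundary g))
  dsimp only at hm
  have hmap : ∀ {g g' : Boundary i} (a : g ⟶ g'), m g ≫ P.map a.hom.right = m g' := by
    intro g g' a
    refine (σ.isUniversal _).hom_ext ?_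
    have ha : g.obj.hom ≫ a.hom.right = g'.obj.hom := Under.w a.hom
    have hg : ∀ f : Under g'.obj.right, Under.mk ((g.obj.hom ≫ a.hom.right) ≫ f.hom) ∈
        {f : Under i | boundaryProp i f} := by
      rw [ha]; exact hI.comp_mem_boundary g'
    rw [← Sec.pull_pull, ← σ.push_sec, ← Sec.push_pull, hm, hm, Sec.push_push _ _ _ _ hg]
    exact τ.push_congr ha _ _
  have hb : ∀ g : Boundary i, m g ≫ (σ.sec g.obj.right).base = τ.base ≫ A.map g.obj.hom :=
    fun g => congr_arg Sec.base (hm g)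
  let t : X ⟶ pullback (matchingMap A i) (matchingObjMap σ.proj i) :=
    pullback.lift τ.base (matchingLift m hmap) (matchingObj_hom_ext fun g => by
      rw [Category.assoc, Category.assoc, matchingMap_proj, matchingObjMap_proj,
        reassoc_of% matchingLift_proj]
      exact (hb g).symm)
  have ht : ∀ g, t ≫ σ.matchingFst i g = m g := fun g => by
    rw [matchingFst, pullback.lift_snd_assoc, matchingLift_proj]
  refine ⟨t, Sec.ext_push hI (pullback.lift_fst _ _ _) fun g => ?_, fun t' ht' => ?_⟩
  · rw [Sec.push_pull, push_boundarySec σ hI, Sec.pull_pull, ht, hm]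
  · apply pullback.hom_ext
    · exact (congr_arg Sec.base ht').trans (pullback.lift_fst _ _ _).symm
    · refine matchingObj_hom_ext fun g => ?_
      rw [Category.assoc, Category.assoc]
      change t' ≫ σ.matchingFst i g = t ≫ σ.matchingFst i g
      rw [ht]
      refine (σ.isUniversal _).hom_ext ?_
      rw [hm, ← Sec.pull_pull, ← push_boundarySec σ hI, ← Sec.push_pull, ht']

/-- The relative matching maps of a pushforward are universal lifts. -/
theorem isUnivLift (hI : IsInverseCategory I) (i : I) :
    IsUnivLift ((σ.boundarySec i).stepMap (hI.isCosieveStep_univ i)) (relativeMatchingMap k i)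
      (relativeMatchingMap σ.proj i) (((σ.sec i).fam _ (hI.isCosieveStep_univ i).mem).cast
        (by
          rw [← Category.assoc]
          exact congr_arg (· ≫ _) (relativeMatchingMap_fst σ.proj i).symm)) :=
  (σ.isUniversal i).isUnivLift (hI.isCosieveStep_univ i) (σ.isUniversal_boundarySec hI i) _
    (σ.pull_boundarySec hI i)

theorem isReedyFibration (hI : IsInverseCategory I) {F : MorphismProperty C}
    [F.IsStableUnderBaseChange] (hF : FibrationsStableUnderPushforward F)
    (hp : ∀ i, F (p.app i)) (hk : IsReedyFibration F k) : IsReedyFibration F σ.proj :=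
  fun i => (σ.isUnivLift hI i).fibration hF (hp i) (hk i)

end UniversalSections

end ReedyPushforward

/-! ### Comparison with the pushforward along the single map `p_i`. -/

section HomotopicalPushforward

variable {I : Type u₁} [Category.{v₁} I] {C : Type u₂} [Category.{v₂} C] {A B K P : I ⥤ C}
  {p : B ⟶ A} {k : K ⟶ B}

/-- The frame at `i` for which universal sections compute the pushforward of `K_i` along `p_i`. -/
abbrev Frame.const (p : B ⟶ A) (i : I) : Frame B i where
  base := A.obj i
  D := (Functor.const I).obj (A.obj i)
  E := (Functor.const I).obj (B.obj i)
  π := (Functor.const I).map (p.app i)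
  α _ := 𝟙 _
  α_map _ := Category.comp_id _
  e f := B.map f.hom
  e_map h := by
    rw [← B.map_comp]
    exact (congr_arg (fun x => B.map x) (Under.w h)).trans (Category.id_comp _).symm

theorem comp_map_eq {i j : I} (f : i ⟶ j) {X : C} {a : X ⟶ A.obj i} {y : X ⟶ B.obj i}
    (w : a = y ≫ p.app i) : a ≫ A.map f = (y ≫ B.map f) ≫ p.app j := by
  rw [Category.assoc, p.naturality, reassoc_of% w]

/-- The restriction of a section along the maps `B_i ⟶ B_j`. -/
def Sec.toConst {i : I} {S : Set (Under i)} {T : C} (σ : Sec k (Frame.push p i) S T) :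
    Sec k (Frame.const p i) S T where
  base := σ.base
  fam f hf :=
    { app := fun t y w => (σ.fam f hf).app t (y ≫ B.map f.hom)
        ((Category.assoc _ _ _).symm.trans
          (comp_map_eq f.hom ((congr_arg (t ≫ ·) (Category.comp_id σ.base).symm).trans w)))
      comp_app := fun r t y w w' => by
        refine ((σ.fam f hf).comp_app r _ _ _ ((Category.assoc _ _ _).symm.trans
          ((comp_map_eq f.hom ((congr_arg ((r ≫ t) ≫ ·) (Category.comp_id σ.base).symm).trans
            w')).trans (congr_arg (· ≫ _) (Category.assoc _ _ _))))).trans ?_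
        exact (σ.fam f hf).app_congr rfl (Category.assoc _ _ _).symm _ }
  fam_comp {f} hf X t y w := (σ.fam_comp hf _ _ _).trans (Category.comp_id _)
  fam_map {f f'} hf hf' h X t y w w' := by
    refine (σ.fam_map hf hf' h _ _ _ (Frame.comp_π _ ((Category.assoc _ _ _).symm.trans
      (comp_map_eq f.hom ((congr_arg (t ≫ ·) (Category.comp_id σ.base).symm).trans w))) h)).trans ?_
    refine (σ.fam f' hf').app_congr rfl ?_ _
    refine (Category.assoc _ _ _).trans (congr (congr_arg _ (Category.comp_id y).symm) ?_)
    exact (B.map_comp _ _).symm.trans (congr_arg (fun x => B.map x) (Under.w h))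

/-- Universal sections for `Frame.const p i` over all maps out of `i` are universal lifts along
`p_i`. -/
theorem Sec.IsUniversal.isUnivLift_const {i : I} {R : C}
    {τ : Sec k (Frame.const p i) Set.univ R} (h : τ.IsUniversal) :
    IsUnivLift (FibMap.snd (𝟙 (A.obj i)) (p.app i)) (k.app i) τ.base
      (τ.fam (Under.mk (𝟙 i)) trivial) := by
  -- All fibre products for the constant frame are the same `X ×_{A_i} B_i`, so the identity
  -- component determines all others by postcomposition with `K`.
  have key : ∀ {X T : C} (τ : Sec k (Frame.const p i) Set.univ X) (f : Under i) (t : T ⟶ X)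
      (y : T ⟶ B.obj i) (w : t ≫ τ.base ≫ 𝟙 _ = y ≫ p.app i),
      (τ.fam f trivial).app t y w = (τ.fam (Under.mk (𝟙 i)) trivial).app t y w ≫ K.map f.hom := by
    intro X T τ f t y w
    let h : Under.mk (𝟙 i) ⟶ f := Under.homMk f.hom (Category.id_comp _)
    refine Eq.trans ?_ (τ.fam_map (f := Under.mk (𝟙 i)) (f' := f) trivial trivial h t y w
      (Frame.comp_π _ w h)).symm
    exact (τ.fam f trivial).app_congr rfl (Category.comp_id y).symm _
  have ext : ∀ {X : C} {τ τ' : Sec k (Frame.const p i) Set.univ X}, τ.base = τ'.base →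
      (∀ {T : C} (t : T ⟶ X) (y : T ⟶ B.obj i) (w : t ≫ τ.base ≫ 𝟙 _ = y ≫ p.app i)
        (w' : t ≫ τ'.base ≫ 𝟙 _ = y ≫ p.app i), (τ.fam (Under.mk (𝟙 i)) trivial).app t y w =
          (τ'.fam (Under.mk (𝟙 i)) trivial).app t y w') → τ = τ' := by
    intro X τ τ' hb H
    refine Sec.ext' hb fun f _ T t y w w' => ?_
    exact (key τ f t y w).trans ((congr_arg (· ≫ K.map f.hom) (H t y w w')).trans
      (key τ' f t y w').symm)
  refine ⟨fun t y w => ?_, fun {X} a u hu => ?_, fun {X} t t' ht hs => ?_⟩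
  · refine (τ.fam_comp (f := Under.mk (𝟙 i)) trivial t y w).trans ?_
    exact (congr_arg (y ≫ ·) (B.map_id i)).trans (Category.comp_id y)
  · let υ : Sec k (Frame.const p i) Set.univ X :=
      { base := a
        fam := fun f _ => u.post (K.map f.hom)
        fam_comp := fun {f} _ {T} t y w => by
          refine (Category.assoc _ _ _).trans ((congr_arg (u.app t y w ≫ ·)
            (k.naturality f.hom)).trans ((Category.assoc _ _ _).symm.trans ?_))
          exact congr_arg (· ≫ B.map f.hom) (hu t y w)
        fam_map := fun {f f'} _ _ h {T} t y w w' => by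
          refine (Category.assoc _ _ _).trans ?_
          refine congr (congr_arg _ (u.app_congr rfl (Category.comp_id y).symm _)) ?_
          exact (K.map_comp _ _).symm.trans (congr_arg (fun x => K.map x) (Under.w h)) }
    obtain ⟨t, ht, -⟩ := h υ
    have hta : t ≫ τ.base = a := congr_arg Sec.base ht
    refine ⟨t, hta, fun s y w w' => ?_⟩
    have w₁ : s ≫ (τ.pull t).base ≫ 𝟙 _ = y ≫ p.app i :=
      (congr_arg (fun x : X ⟶ A.obj i => s ≫ x ≫ 𝟙 _) hta).trans w'
    refine (Sec.fam_congr ht (f := Under.mk (𝟙 i)) trivial rfl rfl w₁ w').trans ?_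
    exact (congr_arg (u.app s y w' ≫ ·) (K.map_id i)).trans (Category.comp_id _)
  · refine h.hom_ext (ext ht fun s y w w' => ?_)
    have hb : ∀ t : X ⟶ R, s ≫ (t ≫ τ.base) ≫ 𝟙 (A.obj i) = (s ≫ t) ≫ τ.base ≫ 𝟙 (A.obj i) :=
      fun t => by simp
    exact hs s y ((hb t).symm.trans w) ((hb t').symm.trans w')

variable [HasFiniteLimits C] [∀ i : I, Finite (Under i)] {F W : MorphismProperty C}

/-- If all maps `A_i ⟶ A_j` and `B_i ⟶ B_j` are weak equivalences, then the universal sections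
for `Frame.push p i` and for `Frame.const p i` are weakly equivalent. -/
theorem Sec.IsUniversal.weakEquivalence_toConst [W.HasTwoOutOfThreeProperty]
    [F.IsMultiplicative] [F.IsStableUnderBaseChange]
    (hI : IsInverseCategory I) (hW : MorphismProperty.isomorphisms C ≤ W)
    (hF : FibrationsStableUnderPushforward F) (hpb : PullbacksLogicallyBehaved F W)
    (hpf : PushforwardsLogicallyBehaved F W) (hp : ∀ j, F (p.app j)) (hk : IsReedyFibration F k)
    {i : I} (hA : ∀ f : Under i, W (A.map f.hom)) (hB : ∀ f : Under i, W (B.map f.hom))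
    {S : Set (Under i)} (hS : IsCosieve S) {Q R : C} {σ : Sec k (Frame.push p i) S Q}
    {τ : Sec k (Frame.const p i) S R} (hσ : σ.IsUniversal) (hτ : τ.IsUniversal) (c : Q ⟶ R)
    (hc : τ.pull c = σ.toConst) : W c := by
  revert Q R σ τ
  refine hI.cosieve_induction (motive := fun S => ∀ {Q R : C} {σ : Sec k (Frame.push p i) S Q}
    {τ : Sec k (Frame.const p i) S R}, σ.IsUniversal → τ.IsUniversal → ∀ c : Q ⟶ R,
    τ.pull c = σ.toConst → W c) ?_ ?_ S hS
  -- Over the empty cosieve both universal objects are `A_i`, up to isomorphism.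
  · intro Q R σ τ hσ hτ c hc
    refine hW _ ?_
    have h₁ : IsIso σ.base := (Sec.isUniversal_ofEmpty k (Frame.push p i)).isIso hσ (t := σ.base)
      (Sec.ext' (Category.comp_id _) fun _ hf => hf.elim)
    have h₂ : IsIso τ.base := (Sec.isUniversal_ofEmpty k (Frame.const p i)).isIso hτ (t := τ.base)
      (Sec.ext' (Category.comp_id _) fun _ hf => hf.elim)
    have h₃ : c ≫ τ.base = σ.base := congr_arg Sec.base hc
    have : IsIso (c ≫ τ.base) := by rw [h₃]; exact h₁
    exact IsIso.of_isIso_comp_right c τ.base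
  · intro S S' f hf ih Q R σ τ hσ hτ c hc
    obtain ⟨Q', σ', hσ', -⟩ := exists_isUniversal (φ := Frame.push p i) hI hF hk hp hf.closed
    obtain ⟨R', τ', hτ', -⟩ := exists_isUniversal (φ := Frame.const p i) hI hF hk
      (fun _ => hp i) hf.closed
    obtain ⟨r, hr, -⟩ := hσ' (σ.restrict hf.subset)
    obtain ⟨r', hr', -⟩ := hτ' (τ.restrict hf.subset)
    obtain ⟨c', hc', -⟩ := hτ' σ'.toConst
    replace hr : σ'.pull r = σ.restrict hf.subset := hr
    replace hr' : τ'.pull r' = τ.restrict hf.subset := hr'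
    replace hc' : τ'.pull c' = σ'.toConst := hc'
    have hcW : W c' := ih hσ' hτ' c' hc'
    have hcomm : c ≫ r' = r ≫ c' := by
      refine hτ'.hom_ext ?_
      rw [← Sec.pull_pull, ← Sec.pull_pull, hr', hc', ← Sec.restrict_pull, hc]
      exact (congr_arg Sec.toConst hr).symm
    have hbc : c' ≫ τ'.base = σ'.base := congr_arg Sec.base hc'
    have hbr : r' ≫ τ'.base = τ.base := congr_arg Sec.base hr'
    have hbr' : r ≫ σ'.base = σ.base := congr_arg Sec.base hr
    have h₁ := hσ.isUnivLift hf hσ' r hr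
    have h₂ := hτ.isUnivLift hf hτ' r' hr'
    have sq := IsPullback.of_hasPullback r' c'
    have h₃ := h₂.baseChange ((τ'.stepMap hf).pull c') rfl (fun _ _ _ _ => rfl) sq
      (((τ.fam f hf.mem).pull (pullback.fst r' c')).cast (by
        rw [← hbr, ← reassoc_of% pullback.condition]; simp)) (fun _ _ _ _ => rfl)
    have hfst : W (pullback.fst r' c') :=
      hpb.along_fibration _ _ _ _ sq (h₂.fibration hF (hp i) (hk f.right)) hcW
    -- Factor `c` as `Q ⟶ Q' ×_{R'} R ⟶ R`. The second map is a pullback of the inductively known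
    -- `c'` along the fibration `r'`; the first compares universal lifts over the same `Q'`, along
    -- `p_j` and along `p_i`.
    rw [← pullback.lift_fst c r hcomm]
    refine W.comp_mem _ _ ?_ hfst
    refine h₁.weakEquivalence_of_base_map hW hpb hpf h₃ (A.map f.hom) (B.map f.hom) ?_
      (p.naturality f.hom) ?_ _ (pullback.lift_snd _ _ _) ?_ (hp f.right) (hp i) (hk f.right)
      (hA f) (hB f)
    · rw [← hbc]; simp
    · intro T t y w w'
      have w₁ : t ≫ (τ'.pull c').base ≫ 𝟙 (A.obj i) = y ≫ p.app i :=
        (congr_arg (t ≫ ·) (Category.assoc _ _ _)).trans w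
      have w₂ : t ≫ σ'.toConst.base ≫ 𝟙 (A.obj i) = y ≫ p.app i :=
        (congr_arg (fun x : Q' ⟶ A.obj i => t ≫ x ≫ 𝟙 _) hbc).symm.trans w₁
      refine (Sec.stepMap_congr hf hc' (f := f) rfl rfl w₁ w₂).trans ?_
      refine (Sec.eq_stepMap_app_iff hf σ' t (y ≫ B.map f.hom) w' _).2
        ⟨(Sec.stepMap_app_fst hf σ'.toConst t y w₂).trans (Category.comp_id _).symm, fun g => ?_⟩
      refine (Sec.stepMap_app_snd_proj hf σ'.toConst t y w₂ g).trans ?_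
      refine (σ'.fam _ (hf.boundary g)).app_congr rfl ?_ _
      refine (congr (congr_arg _ (Category.comp_id y)) (B.map_comp f.hom g.obj.hom)).trans ?_
      exact (Category.assoc _ _ _).symm
    · intro T s y w w'
      have w₁ : s ≫ σ.toConst.base ≫ 𝟙 (A.obj i) = y ≫ p.app i := by
        refine Eq.trans (congr_arg (s ≫ ·) ?_) ((Category.assoc _ _ _).symm.trans w')
        refine Eq.trans (congr_arg (· ≫ 𝟙 (A.obj i)) (?_ : σ.base = r ≫ c' ≫ τ'.base)) ?_
        · rw [hbc, hbr']
        · refine Eq.trans ?_ (pullback.lift_snd_assoc c r hcomm _).symm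
          simp
      have w₂ : s ≫ (τ.pull c).base ≫ 𝟙 (A.obj i) = y ≫ p.app i := by
        rw [hc]; exact w₁
      refine Eq.trans ?_ (Sec.fam_congr hc hf.mem rfl rfl w₂ w₁)
      refine (τ.fam f hf.mem).app_congr ?_ rfl _
      exact (Category.assoc _ _ _).trans (congr_arg (s ≫ ·) (pullback.lift_fst _ _ _))

end HomotopicalPushforward

/-! ### The pushforward is homotopical. -/

section HomotopicalValues

variable {I : Type u₁} [Category.{v₁} I] {C : Type u₂} [Category.{v₂} C] {A B K P : I ⥤ C}
  {p : B ⟶ A} {k : K ⟶ B} [HasFiniteLimits C] [∀ i : I, Finite (Under i)]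
  {F W : MorphismProperty C}

namespace UniversalSections

variable [W.HasTwoOutOfThreeProperty]
  [F.IsMultiplicative] [F.IsStableUnderBaseChange]

/-- If `A` and `B` send all maps out of `i` to weak equivalences, then the value at `i` of a
pushforward is weakly equivalent to the pushforward of `K_i` along `p_i`. -/
theorem exists_weakEquivalence_isUnivLift (σ : UniversalSections p k P) (hI : IsInverseCategory I)
    (hW : MorphismProperty.isomorphisms C ≤ W)
    (hF : FibrationsStableUnderPushforward F) (hpb : PullbacksLogicallyBehaved F W)
    (hpf : PushforwardsLogicallyBehaved F W) (hp : ∀ j, F (p.app j)) (hk : IsReedyFibration F k)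
    {i : I} (hA : ∀ f : Under i, W (A.map f.hom)) (hB : ∀ f : Under i, W (B.map f.hom)) :
    ∃ (R : C) (ρ : R ⟶ A.obj i) (ε : FibMap (ρ ≫ 𝟙 _) (p.app i) (K.obj i)) (c : P.obj i ⟶ R),
      IsUnivLift (FibMap.snd (𝟙 (A.obj i)) (p.app i)) (k.app i) ρ ε ∧
      c ≫ ρ = (σ.sec i).base ∧
      (∀ {T : C} (t : T ⟶ P.obj i) (y : T ⟶ B.obj i) (w : (t ≫ c) ≫ ρ ≫ 𝟙 _ = y ≫ p.app i)
        (w' : t ≫ (σ.sec i).base ≫ A.map (𝟙 i) = y ≫ p.app i),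
        ε.app (t ≫ c) y w = ((σ.sec i).fam (Under.mk (𝟙 i)) trivial).app t y w') ∧ W c := by
  obtain ⟨R, τ, hτ, -⟩ := exists_isUniversal (φ := Frame.const p i) hI hF hk
    (fun _ => hp i) (isCosieve_univ i)
  obtain ⟨c, hc, -⟩ := hτ (σ.sec i).toConst
  replace hc : τ.pull c = (σ.sec i).toConst := hc
  refine ⟨R, τ.base, _, c, hτ.isUnivLift_const, congr_arg Sec.base hc, fun t y w w' => ?_,
    (σ.isUniversal i).weakEquivalence_toConst hI hW hF hpb hpf hp hk hA hB (isCosieve_univ i) hτ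
      c hc⟩
  have w₁ : t ≫ (τ.pull c).base ≫ 𝟙 (A.obj i) = y ≫ p.app i := by
    rw [← w]
    exact (congr_arg (t ≫ ·) (Category.assoc _ _ _)).trans (Category.assoc _ _ _).symm
  have w₂ : t ≫ (σ.sec i).toConst.base ≫ 𝟙 (A.obj i) = y ≫ p.app i := by
    rw [← hc]; exact w₁
  refine (Sec.fam_congr hc (f := Under.mk (𝟙 i)) trivial rfl rfl w₁ w₂).trans ?_
  exact FibMap.app_congr _ rfl ((congr_arg (y ≫ ·) (B.map_id i)).trans (Category.comp_id y)) _

omit [HasFiniteLimits C] [∀ i : I, Finite (Under i)] in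
theorem map_base (σ : UniversalSections p k P) {i j : I} (w : i ⟶ j) :
    P.map w ≫ (σ.sec j).base = (σ.sec i).base ≫ A.map w :=
  (congr_arg Sec.base (σ.push_sec w)).symm

/-- The maps of a pushforward between objects all of whose outgoing maps are weak equivalences
are weak equivalences. -/
theorem weakEquivalence_map_of_forall (σ : UniversalSections p k P) (hI : IsInverseCategory I)
    (hW : MorphismProperty.isomorphisms C ≤ W)
    (hF : FibrationsStableUnderPushforward F) (hpb : PullbacksLogicallyBehaved F W)
    (hpf : PushforwardsLogicallyBehaved F W) (hp : ∀ j, F (p.app j)) (hk : IsReedyFibration F k)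
    {i j : I} (w : i ⟶ j)
    (hA : ∀ f : Under i, W (A.map f.hom)) (hB : ∀ f : Under i, W (B.map f.hom))
    (hA' : ∀ f : Under j, W (A.map f.hom)) (hB' : ∀ f : Under j, W (B.map f.hom))
    (hK : W (K.map w)) : W (P.map w) := by
  obtain ⟨R, ρ, ε, c, h, hc, hε, hcW⟩ :=
    σ.exists_weakEquivalence_isUnivLift hI hW hF hpb hpf hp hk hA hB
  obtain ⟨R', ρ', ε', c', h', hc', hε', hcW'⟩ :=
    σ.exists_weakEquivalence_isUnivLift hI hW hF hpb hpf hp hk hA' hB'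
  have hki : ∀ i, F (k.app i) := IsReedyFibration.app hI hF hk
  have hAw : W (A.map w) := hA (Under.mk w)
  have hBw : W (B.map w) := hB (Under.mk w)
  -- `Z` is `(p_i)_*(B_w^* K_j)`, the common target of `a`, induced by `K_w`, and of `b`, the
  -- comparison map from `A_w^* (p_j)_* K_j`.
  obtain ⟨Z, r, ζ, hZ⟩ := hF.exists_isUnivLift (hp i)
    ((FibMap.snd (𝟙 (A.obj i)) (p.app i)).post (B.map w)) (hki j)
  obtain ⟨a, har, ha⟩ := hZ.exists_lift ρ (ε.post (K.map w)) (fun t y w' => by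
    refine (Category.assoc _ _ _).trans ((congr_arg (ε.app t y w' ≫ ·) (k.naturality w)).trans
      ((Category.assoc _ _ _).symm.trans ?_))
    exact congr_arg (· ≫ B.map w) (h.fac t y w'))
  have haW : W a := h.weakEquivalence_of_fibration_map hpb hpf hZ (B.map w) (K.map w)
    (k.naturality w) (fun _ _ _ => rfl) a har (fun s y w₁ w₂ => ha s y w₂ w₁) (hp i) (hki i)
    (hki j) hK hBw
  have sq := IsPullback.of_hasPullback ρ' (A.map w)
  have h'' := h'.baseChange (FibMap.snd (A.map w) (p.app j)) (Category.comp_id _)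
    (fun _ _ _ _ => rfl) sq ((ε'.pull (pullback.fst ρ' (A.map w))).cast
      (by rw [Category.comp_id, pullback.condition])) (fun _ _ _ _ => rfl)
  let u : FibMap (pullback.snd ρ' (A.map w) ≫ 𝟙 _) (p.app i) (K.obj j) :=
    { app := fun t y w₁ => ε'.app (t ≫ pullback.fst ρ' (A.map w)) (y ≫ B.map w) (by
        rw [Category.comp_id] at w₁
        rw [Category.comp_id, Category.assoc, pullback.condition, ← Category.assoc]
        exact comp_map_eq w w₁)
      comp_app := fun s t y w₁ w₂ => by
        rw [Category.comp_id] at w₂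
        refine (ε'.comp_app s _ _ _ ?_).trans (ε'.app_congr (Category.assoc _ _ _).symm
          (Category.assoc _ _ _).symm _)
        rw [Category.comp_id, Category.assoc, Category.assoc, pullback.condition,
          ← Category.assoc t, ← Category.assoc s, ← Category.assoc s t, ← Category.assoc s y]
        exact comp_map_eq w w₂ }
  obtain ⟨b, hbr, hb⟩ := hZ.exists_lift (pullback.snd ρ' (A.map w)) u
    (fun t y w₁ => h'.fac _ _ _)
  have hbW : W b := h''.weakEquivalence_of_base_map hW hpb hpf hZ (A.map w) (B.map w)
    (Category.id_comp _) (p.naturality w) (fun _ _ _ _ => rfl) b hbr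
    (fun s y w₁ w₂ => hb s y w₂ (by
      refine Eq.trans ?_ w₂
      rw [← reassoc_of% hbr]; simp)) (hp j) (hp i)
    (hki j) hAw hBw
  -- The gap map of `P_w` over `A_w`, followed by the equivalence `P_j ⟶ R'`. Once `x ≫ b = c ≫ a`
  -- is known, 2-out-of-3 transfers from `a`, `b` and `c` to `x`, and then to `P_w`.
  let x : P.obj i ⟶ pullback ρ' (A.map w) := pullback.lift (P.map w ≫ c') (σ.sec i).base
    (by rw [Category.assoc, hc', map_base])
  have hx₁ : x ≫ pullback.fst ρ' (A.map w) = P.map w ≫ c' := pullback.lift_fst _ _ _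
  have hx₂ : x ≫ pullback.snd ρ' (A.map w) = (σ.sec i).base := pullback.lift_snd _ _ _
  have hxb : x ≫ b = c ≫ a := by
    refine hZ.hom_ext _ _ (by rw [Category.assoc, Category.assoc, hbr, har, hx₂, hc])
      fun {T} s y w₁ w₂ => ?_
    have w₃ : s ≫ (σ.sec i).base = y ≫ p.app i := by
      rw [← w₁, ← hx₂, ← hbr]; simp
    have w₄ : s ≫ (σ.sec i).base ≫ A.map (𝟙 i) = y ≫ p.app i := by
      rw [← w₃, A.map_id, Category.comp_id]
    let e : Under.mk (𝟙 i) ⟶ Under.mk w := Under.homMk w (Category.id_comp _)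
    have w₅ := Frame.comp_π (Frame.push p i) w₄ e
    have w₆ : (s ≫ P.map w) ≫ (σ.sec j).base ≫ A.map (𝟙 j) = (y ≫ B.map w) ≫ p.app j := by
      rw [A.map_id, Category.comp_id, Category.assoc, map_base]
      exact w₅
    have w₇ : (s ≫ c) ≫ ρ ≫ 𝟙 (A.obj i) = y ≫ p.app i := by
      rw [← w₃, ← hc]; simp
    have w₈ : (s ≫ x) ≫ pullback.snd ρ' (A.map w) ≫ 𝟙 (A.obj i) = y ≫ p.app i := by
      rw [← w₃, ← hx₂]; simp
    have w₉ : ((s ≫ P.map w) ≫ c') ≫ ρ' ≫ 𝟙 (A.obj j) = (y ≫ B.map w) ≫ p.app j := by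
      rw [← w₆, ← hc']; simp
    trans ((σ.sec i).fam (Under.mk w) trivial).app s (y ≫ B.map w) w₅
    · refine (ζ.app_congr (Category.assoc _ _ _).symm rfl _).trans
        ((hb (s ≫ x) y ((congr_arg (· ≫ _) (Category.assoc _ _ _)).trans w₁) w₈).trans ?_)
      refine Eq.trans ?_ ((hε' (s ≫ P.map w) (y ≫ B.map w) w₉ w₆).trans
        (σ.fam_id_app w s (y ≫ B.map w) w₆ w₅))
      exact ε'.app_congr (by rw [Category.assoc, hx₁, Category.assoc]) rfl _
    · refine Eq.trans ((σ.sec i).fam_map (f := Under.mk (𝟙 i)) (f' := Under.mk w) trivial trivial e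
        s y w₄ w₅).symm ?_
      refine Eq.trans ?_ ((ha (s ≫ c) y ((congr_arg (· ≫ _) (Category.assoc _ _ _)).trans w₂)
        w₇).symm.trans (ζ.app_congr (Category.assoc _ _ _) rfl _))
      exact congr_arg (· ≫ K.map w) (hε s y w₇ w₄).symm
  have hxW : W x := W.of_postcomp x b hbW (by rw [hxb]; exact W.comp_mem _ _ hcW haW)
  refine W.of_postcomp _ c' hcW' ?_
  rw [← hx₁]
  exact W.comp_mem _ _ hxW (hpb.along_fibration _ _ _ _ sq (h'.fibration hF (hp j) (hki j)) hAw)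

end UniversalSections

/-- If `w : i ⟶ j` is initial in `∂(i/I)`, then `M_i X` is `X_j`. -/
theorem isIso_matchingProj_of_isInitial (X : I ⥤ C) {i : I} {g : Boundary i} (hg : IsInitial g) :
    IsIso (matchingProj X i g) :=
  isIso_π_of_isInitial hg (boundaryDiagram X i)

/-- Since `M_i X ≅ X_j`, the map `X_w` is the relative matching map followed by the projection `Y_i
×_{Y_j} X_j ⟶ X_j`. The latter is the pullback of `Y_w` along the fibration `q_j`, hence a weak
equivalence. -/
theorem weakEquivalence_map_iff_relativeMatchingMap [W.HasTwoOutOfThreeProperty]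
    (hpb : PullbacksLogicallyBehaved F W)
    {X Y : I ⥤ C} (q : X ⟶ Y) {i : I} {g : Boundary i} (hg : IsInitial g)
    (hY : W (Y.map g.obj.hom)) (hq : F (q.app g.obj.right)) :
    W (X.map g.obj.hom) ↔ W (relativeMatchingMap q i) := by
  have hX' := isIso_matchingProj_of_isInitial X hg
  have hY' := isIso_matchingProj_of_isInitial Y hg
  have sq := (IsPullback.of_hasPullback (matchingMap Y i) (matchingObjMap q i)).flip.paste_horiz
    (IsPullback.of_horiz_isIso ⟨(matchingObjMap_proj q i g).symm⟩)
  rw [matchingMap_proj] at sq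
  have h := hpb.along_fibration _ _ _ _ sq hq hY
  rw [← matchingMap_proj, ← relativeMatchingMap_snd q, Category.assoc]
  exact ⟨fun H => W.of_postcomp _ _ h H, fun H => W.comp_mem _ _ H h⟩

/-- Pushforwards of homotopical Reedy fibrations along homotopical Reedy fibrations are
homotopical. -/
theorem UniversalSections.isHomotopical (σ : UniversalSections p k P)
    [W.HasTwoOutOfThreeProperty] [F.IsMultiplicative] [F.IsStableUnderBaseChange]
    (hI : IsInverseCategory I) {WI : MorphismProperty I} [WI.HasTwoOutOfThreeProperty]
    (hW : MorphismProperty.isomorphisms C ≤ W)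
    (hF : FibrationsStableUnderPushforward F) (hpb : PullbacksLogicallyBehaved F W)
    (hpf : PushforwardsLogicallyBehaved F W)
    (hshape : ∀ ⦃i j : I⦄ (w : i ⟶ j) (hw : ¬ MorphismProperty.identities I w), WI w →
      (∀ ⦃l : I⦄ (f : i ⟶ l), WI f) ∨ Nonempty (IsInitial (Boundary.mk w hw)))
    (hp : IsHomotopicalReedyFibration WI F W p) (hk : IsHomotopicalReedyFibration WI F W k) :
    IsHomotopical WI W P := by
  have hpi := IsReedyFibration.app hI hF hp.reedy
  have hki := IsReedyFibration.app hI hF hk.reedy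
  have hPi := IsReedyFibration.app hI hF (σ.isReedyFibration hI hF hpi hk.reedy)
  intro i j w hw
  by_cases hid : MorphismProperty.identities I w
  · cases hid
    exact hW _ (inferInstanceAs (IsIso _))
  rcases hshape w hid hw with hall | ⟨⟨hg⟩⟩
  · have hall' : ∀ f : Under j, WI f.hom := fun f => WI.of_precomp w f.hom hw (hall _)
    exact σ.weakEquivalence_map_of_forall hI hW hF hpb hpf hpi hk.reedy w
      (fun f => hp.target _ (hall _)) (fun f => hp.source _ (hall _))
      (fun f => hp.target _ (hall' f)) (fun f => hp.source _ (hall' f)) (hk.source w hw)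
  · refine (weakEquivalence_map_iff_relativeMatchingMap (F := F) hpb σ.proj hg (hp.target w hw)
      (hPi j)).2 ?_
    have hkW := (weakEquivalence_map_iff_relativeMatchingMap (F := F) hpb k hg
      (hk.target w hw) (hki j)).1 (hk.source w hw)
    have h := σ.isUnivLift hI i
    -- The relative matching map of `K`, seen as a weak equivalence to the trivial fibration `𝟙`,
    -- pushes forward to that of `P`, because the universal lift through `𝟙` is the identity of the
    -- base.
    have h' := isUnivLift_id ((σ.boundarySec i).stepMap (hI.isCosieveStep_univ i))
      (((σ.boundarySec i).stepMap (hI.isCosieveStep_univ i)).cast (Category.id_comp _).symm)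
      (fun _ _ _ _ => rfl)
    refine h.weakEquivalence_of_fibration_map hpb hpf h' (𝟙 _) (relativeMatchingMap k i) rfl
      (fun t y w => (Category.comp_id _).symm) _ (Category.comp_id _) (fun s y w w' => ?_) (hpi i)
      (hk.reedy i) (F.id_mem _) hkW (hW _ (inferInstanceAs (IsIso (𝟙 _))))
    exact (h.fac s y w).symm

end HomotopicalValues

end InverseDiagrams

/-! ### The main theorem. -/

open InverseDiagrams in
theorem mainTheorem1 {I : Type u₁} [Category.{v₁} I] {C : Type u₂} [Category.{v₂} C]
    (hI : IsInverseCategory I) [∀ i : I, Finite (Under i)] [HasFiniteLimits C]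
    (WI : MorphismProperty I) [WI.HasTwoOutOfThreeProperty]
    (hWI : MorphismProperty.isomorphisms I ≤ WI)
    (W : MorphismProperty C) [W.HasTwoOutOfThreeProperty]
    (hW : MorphismProperty.isomorphisms C ≤ W)
    (F : MorphismProperty C) [F.IsMultiplicative] [F.IsStableUnderBaseChange]
    (hF : FibrationsStableUnderPushforward F)
    (hpb : PullbacksLogicallyBehaved F W)
    (hpf : PushforwardsLogicallyBehaved F W)
    (hshape : ∀ ⦃i j : I⦄ (w : i ⟶ j) (hw : ¬ MorphismProperty.identities I w), WI w →
      (∀ ⦃l : I⦄ (f : i ⟶ l), WI f) ∨ Nonempty (IsInitial (Boundary.mk w hw)))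
    {A B K : I ⥤ C} (p : B ⟶ A) (k : K ⟶ B)
    (hp : IsHomotopicalReedyFibration WI F W p)
    (hk : IsHomotopicalReedyFibration WI F W k) :
    (∃ (P : Over A) (ev : (Over.pullback p).obj P ⟶ Over.mk k),
      IsPushforward p (Over.mk k) P ev) ∧
    ∀ (P : Over A) (ev : (Over.pullback p).obj P ⟶ Over.mk k),
      IsPushforward p (Over.mk k) P ev → IsHomotopicalReedyFibration WI F W P.hom := by
  have hpi := IsReedyFibration.app hI hF hp.reedy
  obtain ⟨P, ⟨σ⟩⟩ := UniversalSections.exists_of_isUniversal (p := p) (k := k) fun i => by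
    obtain ⟨Q, σ, hσ, -⟩ := exists_isUniversal (φ := Frame.push p i) hI hF hk.reedy hpi
      (isCosieve_univ i)
    exact ⟨Q, σ, hσ⟩
  refine ⟨⟨Over.mk σ.proj, σ.ev, σ.isPushforward⟩, fun Q ev h => ?_⟩
  -- An arbitrary pushforward is isomorphic to the constructed one, so it carries universal sections
  -- itself and the arguments above apply to it directly.
  obtain ⟨τ, hτ⟩ := σ.exists_of_isPushforward h
  rw [← hτ]
  exact ⟨τ.isReedyFibration hI hF hpi hk.reedy,
    τ.isHomotopical hI hW hF hpb hpf hshape hp hk, hp.target⟩
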